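/- Let $(w_k)_{k\ge0}$ be nonnegative real weights with $w_0>0$ and $w_{k+1}/w_k\to a$ as $k\to\infty$, where $0<a<\infty$. Let $\Phi(t)=\sum_{k\ge0}w_kt^k$, with radius of convergence $\rho$, let $\Psi(t)=t\Phi'(t)/\Phi(t)=\sum_k kw_kt^k/\sum_k w_kt^k$ for $0\le t\le\rho$ with $\Phi(t)<\infty$, let $\Psi(\rho)=\lim_{t\uparrow\rho}\Psi(t)$ if $\Phi(\rho)=\infty$, and let $\nu=\Psi(\rho)\in(0,\infty]$. For integers $m\ge0$, $n\ge1$ with $Z(m,n)=\sum_{y\in\mathbb N_0^n,\ \sum y_i=m}\prod_{i}w_{y_i}>0$, let $(Y_1,\dots,Y_n)$ be the random allocation of $m$ balls in $n$ boxes taking the value $y\in\mathbb N_0^n$, $\sum_i y_i=m$, with probability $\prod_i w_{y_i}/Z(m,n)$, and let $Y_{(1)}=\max_iY_i$. Suppose that $n\to\infty$ (through all positive integers) and $m=m(n)=\lambda n+o(\sqrt n)$ with $0<\lambda<\nu$. Then $Z(m,n)>0$ for all large $n$. Let $\tau$ be the unique number in $[0,\rho]$ with $\Psi(\tau)=\lambda$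 (it exists), let $\pi_k=w_k\tau^k/\Phi(\tau)$ and $q=\tau a=\tau/\rho$; then $0<q<1$. Let $k(n)\ge0$ be any integers with $\pi_{k(n)}=\Theta(1/n)$; equivalently, $k(n)=k_1(n)+O(1)$, where $k_1(n)=\max\{k:\pi_k\ge1/n\}$. Let $N=N(n)$ be any nonnegative integers with $$N\sim\frac{n\,\pi_{k(n)}q^{-k(n)}}{1-q}=\frac{n\,w_{k(n)}a^{-k(n)}}{\Phi(\tau)(1-q)}.$$ Let $W$ have the Gumbel distribution, $\mathbb P(W\le x)=e^{-e^{-x}}$ for $x\in\mathbb R$, and write $X_n\approx X_n'$ if the total variation distance of the laws of $X_n$ and $X'_n$ tends to $0$. Then the following hold. (i) $Y_{(1)}\approx\max_{i\le N}\eta_i$, where $\eta_1,\dots,\eta_N$ are i.i.d. geometric $\mathrm{Ge}(1-q)$, that is, $\mathbb P(\eta_i=k)=(1-q)q^k$ for $k\ge0$. (ii) $Y_{(1)}\approx\lfloor W/\log(1/q)+\log_{1/q}N\rfloor$. (iii) Let $b_n=n\pi_{k(n)}$; then $b_n=\Theta(1)$ and $Y_{(1)}-k(n)\approx\lfloor (W+\log(b_n/(1-q)))/\log(1/q)\rfloor$.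 The sequence $Y_{(1)}-k(n)$ is tight, and along every subsequence for which $b_n$ converges to some $b$ it converges in distribution, to $\lfloor (W+\log(b/(1-q)))/\log(1/q)\rfloor$. Nevertheless $Y_{(1)}-k(n)$ has no limit distribution as $n\to\infty$. -/

import Mathlib

open Filter Topology MeasureTheory ProbabilityTheory Asymptotics
open scoped ENNReal NNReal

noncomputable section

namespace BallsInBoxes

/-- The generating function `Φ(t) = ∑ w_k t^k` of the weights, for `t ∈ [0, ∞]`. -/
def genFun (w : ℕ → ℝ≥0) (t : ℝ≥0∞) : ℝ≥0∞ := ∑' k : ℕ, (w k : ℝ≥0∞) * t ^ k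

/-- The radius of convergence `ρ ∈ [0, ∞]` of `Φ`. -/
def rho (w : ℕ → ℝ≥0) : ℝ≥0∞ :=
  (FormalMultilinearSeries.ofScalars ℝ (fun k => (w k : ℝ))).radius

/-- The quotient `∑ k w_k t^k / ∑ w_k t^k`. -/
def psiQuot (w : ℕ → ℝ≥0) (t : ℝ≥0∞) : ℝ≥0∞ :=
  (∑' k : ℕ, (k : ℝ≥0∞) * ((w k : ℝ≥0∞) * t ^ k)) / genFun w t

/-- `Ψ(t) = t Φ'(t) / Φ(t)` where `Φ(t) < ∞`. If `Φ(t) = ∞`, the limit from the left is taken;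
this is used only for `t ≤ ρ`, hence only at `t = ρ`. -/
def psi (w : ℕ → ℝ≥0) (t : ℝ≥0∞) : ℝ≥0∞ :=
  open Classical in
  if genFun w t < ∞ then psiQuot w t else limUnder (𝓝[<] t) (psiQuot w)

/-- `ν = Ψ(ρ)`. -/
def nu (w : ℕ → ℝ≥0) : ℝ≥0∞ := psi w (rho w)

/-- `π_k = w_k τ^k / Φ(τ)`. -/
def boxProb (w : ℕ → ℝ≥0) (τ : ℝ≥0) (k : ℕ) : ℝ :=
  (w k : ℝ) * (τ : ℝ) ^ k / (genFun w τ).toReal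

/-- `k₁(n) = max {k : π_k ≥ 1/n}`. -/
def kOne (w : ℕ → ℝ≥0) (τ : ℝ≥0) (n : ℕ) : ℕ :=
  sSup {k : ℕ | 1 / (n : ℝ) ≤ boxProb w τ k}

/-- The set of allocations of `m` balls in `n` boxes: all `y ∈ ℕ^n` with `∑ y_i = m`. -/
def allocations (m n : ℕ) : Finset (Fin n → ℕ) := Finset.piAntidiag Finset.univ m

/-- The weight `w(y) = ∏ w_{y_i}` of an allocation. -/
def weight (w : ℕ → ℝ≥0) {n : ℕ} (y : Fin n → ℕ) : ℝ≥0 := ∏ i, w (y i)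

/-- The partition function `Z(m,n)`. -/
def partitionFun (w : ℕ → ℝ≥0) (m n : ℕ) : ℝ≥0 := ∑ y ∈ allocations m n, weight w y

/-- The random allocation `B_{m,n}`: allocations have probability `w(y) / Z(m,n)`.
In the excluded case `Z(m,n) = 0` the value is a placeholder. -/
def randomAllocation (w : ℕ → ℝ≥0) (m n : ℕ) : PMF (Fin n → ℕ) :=
  open Classical in
  if h : partitionFun w m n = 0 then PMF.pure 0
  else PMF.ofFinset
    (fun y => if y ∈ allocations m n then ((weight w y / partitionFun w m n : ℝ≥0) : ℝ≥0∞) else 0)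
    (allocations m n)
    (by
      rw [Finset.sum_congr rfl (fun y hy => if_pos hy), ← ENNReal.ofNNReal_finsetSum,
        ← Finset.sum_div]
      change (((partitionFun w m n) / (partitionFun w m n) : ℝ≥0) : ℝ≥0∞) = 1
      rw [div_self h, ENNReal.coe_one])
    (fun _ hy => if_neg hy)

/-- The law of the maximal occupancy `Y_(1) = max_i Y_i`, as a distribution on `ℤ`. -/
def maxOccupancy (w : ℕ → ℝ≥0) (m n : ℕ) : PMF ℤ :=
  (randomAllocation w m n).map (fun y => ((Finset.univ.sup y : ℕ) : ℤ))

/-- A distribution on `ℤ` as a point of the space of probability measures (weak topology). -/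
def toProb (p : PMF ℤ) : ProbabilityMeasure ℤ := ⟨p.toMeasure, inferInstance⟩

/-- The law of `max_{i ≤ N} η_i`, for `η_1, …, η_N` i.i.d. `Ge(p)`,
that is, `P(η_i = k) = p (1 - p)^k` for `k ≥ 0`. -/
def maxGeometric (p : unitInterval) (N : ℕ) : Measure ℤ :=
  (Measure.pi (fun _ : Fin N => geometricMeasure p)).map
    (fun x => ((Finset.univ.sup x : ℕ) : ℤ))

/-- The Gumbel distribution function `x ↦ exp (-exp (-x))`. -/
def gumbelCDF : StieltjesFunction ℝ where
  toFun x := Real.exp (-Real.exp (-x))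
  mono' x y h := by
    dsimp only
    gcongr
  right_continuous' x := by
    apply Continuous.continuousWithinAt
    fun_prop

/-- The Gumbel distribution. -/
def gumbel : Measure ℝ := gumbelCDF.measure

theorem tendsto_gumbelCDF_atBot : Tendsto gumbelCDF atBot (𝓝 0) :=
  Real.tendsto_exp_atBot.comp
    (tendsto_neg_atTop_atBot.comp (Real.tendsto_exp_atTop.comp tendsto_neg_atBot_atTop))

theorem tendsto_gumbelCDF_atTop : Tendsto gumbelCDF atTop (𝓝 1) := by
  have h : Tendsto (fun x : ℝ => -Real.exp (-x)) atTop (𝓝 0) := by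
    simpa using (Real.tendsto_exp_atBot.comp tendsto_neg_atTop_atBot).neg
  have h2 := (Real.continuous_exp.tendsto 0).comp h
  rw [Real.exp_zero] at h2
  exact h2

instance : IsProbabilityMeasure gumbel :=
  gumbelCDF.isProbabilityMeasure tendsto_gumbelCDF_atBot tendsto_gumbelCDF_atTop

theorem gumbel_Iic (x : ℝ) :
    gumbel (Set.Iic x) = ENNReal.ofReal (Real.exp (-Real.exp (-x))) := by
  rw [gumbel, gumbelCDF.measure_Iic tendsto_gumbelCDF_atBot, sub_zero]
  rfl

/-- The total variation distance `sup_A |μ(A) - μ'(A)|` of two finite measures. -/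
def tvDist {α : Type*} [MeasurableSpace α] (μ μ' : Measure α) : ℝ :=
  ⨆ A : {A : Set α // MeasurableSet A}, |μ.real A - μ'.real A|

/-- `X_n ≈ X'_n` in distribution, for sequences of random variables with laws `μ n` and `μ' n`:
the total variation distance tends to `0`. -/
def DApprox {α : Type*} [MeasurableSpace α] (μ μ' : ℕ → Measure α) : Prop :=
  Tendsto (fun n => tvDist (μ n) (μ' n)) atTop (𝓝 0)

end BallsInBoxes

end

namespace BallsInBoxes

/-! ### A local limit theorem for truncated sums -/

/-! Replacing `w k` by `π_k = w k τ^k / Φ(τ)` multiplies the weights of all allocations of `m` balls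
by one constant, so the allocation is `n` independent variables of law `π`, of mean `λ`, conditioned
to have sum `m`. Hence `P(Y_(1) ≤ K)` is a quotient of two coefficients: truncated at `K` over
untruncated (`truncCoeff_tilt`, `maxOccupancy_real_Iic`).

Both are found by Fourier inversion. While `n * tailSum π K` stays bounded, truncation only costs a
factor `exp (-n * tailSum π K)`; the remaining Gaussian integral does not depend on `K`
(`LatticeLaw.tendsto_truncCoeff`). Dividing gives `P(Y_(1) ≤ K) = exp (-n * tailSum π K) + o(1)`.

Ratios of consecutive `π_k` tend to `q`, so at `K = k(n) + j` the exponent is `B_n q^(j+1) + o(1)`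
with `B_n = n π_{k(n)} / (1 - q)`. The geometric maximum and the rounded Gumbel variables have the
same asymptotic distribution functions. As `B_n` stays in a compact subset of `(0, ∞)`, no mass
escapes, and on `ℤ` this upgrades to total variation (`HasGumbelCDF.dApprox`).

A limit law would force `B_n` to converge. Then `π_{k(n+1)} / π_{k(n)} → 1`, which geometric decay
allows only if `k(n)` is eventually constant, contradicting `k(n) → ∞`
(`GeomRatio.not_tendsto_mul`).

Finally, `τ` comes from continuity and strict monotonicity of `Ψ` below `ρ` (`mean_div_lt`,
`exists_lt_psiQuot`). -/

theorem norm_exp_I_mul_sub_one_sub_le (t : ℝ) :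
    ‖Complex.exp (Complex.I * t) - 1 - Complex.I * t‖ ≤ 2 * t ^ 2 := by
  have hn : ‖Complex.I * (t : ℂ)‖ = |t| := by simp
  rcases le_or_gt |t| 1 with h | h
  · refine (Complex.norm_exp_sub_one_sub_id_le (by rw [hn]; exact h)).trans ?_
    rw [hn, sq_abs]
    nlinarith [sq_nonneg t]
  · have h1 := Real.norm_exp_I_mul_ofReal_sub_one_le (x := t)
    have h2 := norm_sub_le (Complex.exp (Complex.I * t) - 1) (Complex.I * t)
    rw [hn] at h2
    rw [Real.norm_eq_abs] at h1
    nlinarith [sq_abs t]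

theorem tendsto_mul_exp_sub_one_sub (y : ℝ) :
    Tendsto (fun n : ℕ => (n : ℂ) * (Complex.exp (Complex.I * ((y / √n : ℝ) : ℂ)) - 1
      - Complex.I * ((y / √n : ℝ) : ℂ))) atTop (𝓝 ((-(y ^ 2 / 2) : ℝ) : ℂ)) := by
  rw [tendsto_iff_norm_sub_tendsto_zero]
  have hs : Tendsto (fun n : ℕ => √(n : ℝ)) atTop atTop :=
    Real.tendsto_sqrt_atTop.comp tendsto_natCast_atTop_atTop
  have hlim : Tendsto (fun n : ℕ => |y| ^ 3 * Real.exp |y| / √(n : ℝ)) atTop (𝓝 0) :=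
    tendsto_const_nhds.div_atTop hs
  refine squeeze_zero' (Eventually.of_forall fun _ => norm_nonneg _) ?_ hlim
  filter_upwards [eventually_ge_atTop 1] with n hn
  have hn1 : (1 : ℝ) ≤ √(n : ℝ) := by
    rw [Real.one_le_sqrt]; exact_mod_cast hn
  have hpos : 0 < √(n : ℝ) := by linarith
  have hsq : √(n : ℝ) ^ 2 = n := Real.sq_sqrt (Nat.cast_nonneg n)
  set s := √(n : ℝ)
  have hb := Complex.norm_exp_sub_sum_le_norm_mul_exp (Complex.I * ((y / s : ℝ) : ℂ)) 3
  have hn' : ‖Complex.I * ((y / s : ℝ) : ℂ)‖ = |y| / s := by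
    rw [norm_mul, Complex.norm_I, one_mul, Complex.norm_real, Real.norm_eq_abs, abs_div,
      abs_of_pos hpos]
  rw [hn'] at hb
  have hnc : (n : ℂ) = ((s ^ 2 : ℝ) : ℂ) := by rw [hsq]; simp
  -- Multiplied by `n`, the quadratic Taylor term is exactly the claimed limit, so only the cubic
  -- remainder, of order `1 / √n`, is left.
  have heq : (n : ℂ) * (Complex.exp (Complex.I * ((y / s : ℝ) : ℂ)) - 1
      - Complex.I * ((y / s : ℝ) : ℂ)) - ((-(y ^ 2 / 2) : ℝ) : ℂ) =
      (n : ℂ) * (Complex.exp (Complex.I * ((y / s : ℝ) : ℂ)) -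
        ∑ j ∈ Finset.range 3, (Complex.I * ((y / s : ℝ) : ℂ)) ^ j / (j.factorial : ℂ)) := by
    have hsc : (s : ℂ) ≠ 0 := by exact_mod_cast hpos.ne'
    rw [hnc]
    simp only [Finset.sum_range_succ, Finset.sum_range_zero, Nat.factorial]
    push_cast
    field_simp
    rw [Complex.I_sq]
    ring
  rw [heq, norm_mul]
  have : ‖(n : ℂ)‖ = s ^ 2 := by rw [hsq]; simp
  rw [this]
  calc s ^ 2 * _ ≤ s ^ 2 * ((|y| / s) ^ 3 * Real.exp (|y| / s)) := by gcongr
    _ ≤ s ^ 2 * ((|y| / s) ^ 3 * Real.exp |y|) := by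
        gcongr
        exact div_le_self (abs_nonneg y) hn1
    _ = |y| ^ 3 * Real.exp |y| / s := by field_simp

/-- The product is the `n`-th power of `z n * exp (c n / n)`. Only boundedness of `c` is used: it
will be `n` times a tail mass, which oscillates. -/
theorem tendsto_pow_mul_exp {z : ℕ → ℂ} {c : ℕ → ℝ} {C : ℝ} {L : ℂ} (hc : ∀ n, |c n| ≤ C)
    (h : Tendsto (fun n : ℕ => (n : ℂ) * (z n - 1) + (c n : ℂ)) atTop (𝓝 L)) :
    Tendsto (fun n => z n ^ n * Complex.exp (c n)) atTop (𝓝 (Complex.exp L)) := by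
  have hcn : Tendsto (fun n : ℕ => ((c n / n : ℝ) : ℂ)) atTop (𝓝 0) := by
    rw [tendsto_zero_iff_norm_tendsto_zero]
    refine squeeze_zero (fun _ => norm_nonneg _) (fun n => ?_)
      (tendsto_const_div_atTop_nhds_zero_nat C)
    rw [Complex.norm_real, Real.norm_eq_abs, abs_div, Nat.abs_cast]
    gcongr
    exact hc n
  have hE : Tendsto (fun n : ℕ => Complex.exp ((c n / n : ℝ) : ℂ) - 1) atTop (𝓝 0) := by
    have := (Complex.continuous_exp.tendsto 0).comp hcn
    simpa using this.sub_const 1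
  have h1 := h.mul hE
  rw [mul_zero] at h1
  have h2 : Tendsto (fun n : ℕ => (c n : ℂ) * (Complex.exp ((c n / n : ℝ) : ℂ) - 1))
      atTop (𝓝 0) := by
    refine isBoundedUnder_le_mul_tendsto_zero ?_ hE
    refine isBoundedUnder_of ⟨C, fun n => ?_⟩
    simpa using hc n
  have h3 : Tendsto (fun n : ℕ => (n : ℂ) * (Complex.exp ((c n / n : ℝ) : ℂ) - 1
      - ((c n / n : ℝ) : ℂ))) atTop (𝓝 0) := by
    rw [tendsto_zero_iff_norm_tendsto_zero]
    refine squeeze_zero' (Eventually.of_forall fun _ => norm_nonneg _) ?_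
      (tendsto_const_div_atTop_nhds_zero_nat (C ^ 2))
    have hev := (tendsto_zero_iff_norm_tendsto_zero.1 hcn).eventually (ge_mem_nhds one_pos)
    filter_upwards [hev, eventually_gt_atTop 0] with n hn hn0
    have hb := Complex.norm_exp_sub_one_sub_id_le hn
    rw [norm_mul, Complex.norm_natCast]
    have hn0' : (0 : ℝ) < n := by exact_mod_cast hn0
    calc (n : ℝ) * _ ≤ n * ‖((c n / n : ℝ) : ℂ)‖ ^ 2 := by gcongr
      _ ≤ n * (C / n) ^ 2 := by
        gcongr
        rw [Complex.norm_real, Real.norm_eq_abs, abs_div, Nat.abs_cast]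
        gcongr
        exact hc n
      _ = C ^ 2 / n := by field_simp
  have h4 : Tendsto (fun n : ℕ => (n : ℂ) * (z n * Complex.exp ((c n / n : ℝ) : ℂ) - 1))
      atTop (𝓝 L) := by
    have := ((h.add h1).sub h2).add h3
    simp only [add_zero, sub_zero] at this
    refine this.congr' ?_
    filter_upwards [eventually_gt_atTop 0] with n hn0
    have : (n : ℂ) ≠ 0 := by exact_mod_cast hn0.ne'
    push_cast
    field_simp
    ring
  refine (Complex.tendsto_one_add_pow_exp_of_tendsto h4).congr' ?_
  filter_upwards [eventually_gt_atTop 0] with n hn0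
  have : (n : ℂ) ≠ 0 := by exact_mod_cast hn0.ne'
  rw [add_sub_cancel, mul_pow, ← Complex.exp_nat_mul]
  push_cast
  rw [mul_div_cancel₀ _ this]

/-- The generating polynomial `∑_{k ≤ K} p_k e^{ikθ}` of the truncated sequence on the circle. -/
noncomputable def truncChar (p : ℕ → ℝ) (K : ℕ) (θ : ℝ) : ℂ :=
  ∑ k ∈ Finset.range (K + 1), (p k : ℂ) * Complex.exp (Complex.I * ((k * θ : ℝ) : ℂ))

theorem continuous_truncChar (p : ℕ → ℝ) (K : ℕ) : Continuous (truncChar p K) := by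
  unfold truncChar
  fun_prop

/-- The squared modulus is `(α + β)^2 - 2 α β (1 - cos θ)`; completing the square only adds a
nonnegative term. Squares may be compared because the right side is nonnegative, by AM-GM. -/
theorem norm_add_mul_exp_le {α β : ℝ} (hα : 0 < α) (hβ : 0 < β) (θ : ℝ) :
    ‖(α : ℂ) + β * Complex.exp (Complex.I * θ)‖ ≤
      α + β - α * β / (α + β) * (1 - Real.cos θ) := by
  have hcos := Real.cos_le_one θ
  have hcos' := Real.neg_one_le_cos θ
  have hr : 0 ≤ α + β - α * β / (α + β) * (1 - Real.cos θ) := by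
    have : α * β / (α + β) * (1 - Real.cos θ) ≤ α * β / (α + β) * 2 := by
      gcongr; linarith
    have h2 : α * β / (α + β) * 2 ≤ α + β := by
      rw [div_mul_eq_mul_div, div_le_iff₀ (by positivity)]
      nlinarith [sq_nonneg (α - β), mul_pos hα hβ]
    linarith
  rw [← sq_le_sq₀ (norm_nonneg _) hr, ← Complex.normSq_eq_norm_sq]
  have : Complex.normSq ((α : ℂ) + β * Complex.exp (Complex.I * θ)) =
      (α + β) ^ 2 - 2 * (α * β) * (1 - Real.cos θ) := by
    rw [mul_comm Complex.I, Complex.exp_mul_I, Complex.normSq_apply]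
    simp [← Complex.ofReal_cos, ← Complex.ofReal_sin]
    linear_combination β ^ 2 * Real.sin_sq_add_cos_sq θ
  rw [this]
  have hd : (α + β) * (α * β / (α + β)) = α * β := by field_simp
  nlinarith [sq_nonneg (α * β / (α + β) * (1 - Real.cos θ))]

theorem norm_exp_I_mul_ofReal' (t : ℝ) : ‖Complex.exp (Complex.I * t)‖ = 1 := by
  rw [mul_comm]; exact Complex.norm_exp_ofReal_mul_I t

/-- Cancellation between the two adjacent atoms `l`, `l + 1` alone gives the decay; the other atoms
are bounded by their mass. Since both survive truncation, `c` does not depend on `K`, which provides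
the integrable majorant in the local limit theorem. The factor `2 / π^2` comes from `1 - cos θ ≥ 2
θ^2 / π^2` on `[-π, π]`. -/
theorem exists_norm_truncChar_le {p : ℕ → ℝ} (hp : ∀ k, 0 ≤ p k) (hs : HasSum p 1) {l : ℕ}
    (hl : 0 < p l) (hl' : 0 < p (l + 1)) :
    ∃ c > 0, ∀ K ≥ l + 1, ∀ θ : ℝ, |θ| ≤ Real.pi →
      ‖truncChar p K θ‖ ≤ Real.exp (-(c * θ ^ 2)) := by
  refine ⟨p l * p (l + 1) / (p l + p (l + 1)) * (2 / Real.pi ^ 2), by positivity, ?_⟩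
  intro K hK θ hθ
  set d := p l * p (l + 1) / (p l + p (l + 1)) with hd
  have hd0 : 0 < d := by positivity
  have hsub : ({l, l + 1} : Finset ℕ) ⊆ Finset.range (K + 1) := by
    intro x hx
    simp only [Finset.mem_insert, Finset.mem_singleton] at hx
    simp only [Finset.mem_range]
    omega
  have hne : l ≠ l + 1 := by omega
  have hsum : ∑ k ∈ Finset.range (K + 1), p k ≤ 1 := sum_le_hasSum _ (fun k _ => hp k) hs
  rw [← Finset.sum_sdiff hsub, Finset.sum_pair hne] at hsum
  have hpair : ‖(p l : ℂ) * Complex.exp (Complex.I * ((l * θ : ℝ) : ℂ)) +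
      (p (l + 1) : ℂ) * Complex.exp (Complex.I * (((l + 1 : ℕ) * θ : ℝ) : ℂ))‖ ≤
      p l + p (l + 1) - d * (1 - Real.cos θ) := by
    have heq : (p l : ℂ) * Complex.exp (Complex.I * ((l * θ : ℝ) : ℂ)) +
      (p (l + 1) : ℂ) * Complex.exp (Complex.I * (((l + 1 : ℕ) * θ : ℝ) : ℂ)) =
      Complex.exp (Complex.I * ((l * θ : ℝ) : ℂ)) *
        ((p l : ℂ) + p (l + 1) * Complex.exp (Complex.I * θ)) := by
      have : Complex.exp (Complex.I * (((l + 1 : ℕ) * θ : ℝ) : ℂ)) =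
          Complex.exp (Complex.I * ((l * θ : ℝ) : ℂ)) * Complex.exp (Complex.I * θ) := by
        rw [← Complex.exp_add]
        congr 1
        push_cast
        ring
      rw [this]
      ring
    rw [heq, norm_mul, norm_exp_I_mul_ofReal', one_mul]
    exact norm_add_mul_exp_le hl hl' θ
  have hrest : ‖∑ k ∈ Finset.range (K + 1) \ {l, l + 1},
      (p k : ℂ) * Complex.exp (Complex.I * ((k * θ : ℝ) : ℂ))‖ ≤
      ∑ k ∈ Finset.range (K + 1) \ {l, l + 1}, p k := by
    refine norm_sum_le_of_le _ fun k _ => ?_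
    rw [norm_mul, norm_exp_I_mul_ofReal', mul_one, Complex.norm_real, Real.norm_eq_abs,
      abs_of_nonneg (hp k)]
  have hcos := Real.cos_le_one_sub_mul_cos_sq hθ
  have hmain : ‖truncChar p K θ‖ ≤ 1 - d * (1 - Real.cos θ) := by
    rw [truncChar, ← Finset.sum_sdiff hsub, Finset.sum_pair hne]
    refine (norm_add_le _ _).trans ?_
    linarith
  have h5 : d * (2 / Real.pi ^ 2 * θ ^ 2) ≤ d * (1 - Real.cos θ) := by
    gcongr
    linarith
  have h6 := Real.add_one_le_exp (-(d * (2 / Real.pi ^ 2) * θ ^ 2))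
  linarith

theorem integral_exp_int_mul (j : ℤ) :
    ∫ θ in (-Real.pi)..Real.pi, Complex.exp (Complex.I * ((j * θ : ℝ) : ℂ)) =
      if j = 0 then 2 * (Real.pi : ℂ) else 0 := by
  split_ifs with h
  · simp [h]
    ring
  · have hc : Complex.I * (j : ℂ) ≠ 0 := mul_ne_zero Complex.I_ne_zero (by exact_mod_cast h)
    have := integral_exp_mul_complex (a := -Real.pi) (b := Real.pi) hc
    have he : (fun θ : ℝ => Complex.exp (Complex.I * ((j * θ : ℝ) : ℂ))) =
        fun θ : ℝ => Complex.exp (Complex.I * (j : ℂ) * θ) := by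
      funext θ
      push_cast
      ring_nf
    rw [he, this, div_eq_zero_iff]
    left
    rw [sub_eq_zero, Complex.exp_eq_exp_iff_exists_int]
    exact ⟨j, by push_cast; ring⟩

/-- The partition function of allocations with all entries at most `K`, with weights `p`. -/
noncomputable def truncCoeff (p : ℕ → ℝ) (K m n : ℕ) : ℝ :=
  ∑ y ∈ (allocations m n).filter (fun y => ∀ i, y i ≤ K), ∏ i, p (y i)

/-- Expanding the `n`-th power over all `y` with entries at most `K`, orthogonality of characters
keeps those with sum `m`. -/
theorem truncCoeff_eq_integral (p : ℕ → ℝ) (K m n : ℕ) :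
    ((2 * Real.pi * truncCoeff p K m n : ℝ) : ℂ) = ∫ θ in (-Real.pi)..Real.pi,
      truncChar p K θ ^ n * Complex.exp (-(Complex.I * ((m * θ : ℝ) : ℂ))) := by
  have hexp : ∀ θ : ℝ, truncChar p K θ ^ n * Complex.exp (-(Complex.I * ((m * θ : ℝ) : ℂ))) =
      ∑ y ∈ Fintype.piFinset (fun _ : Fin n => Finset.range (K + 1)),
        ((∏ i, p (y i) : ℝ) : ℂ) *
          Complex.exp (Complex.I * ((((∑ i, y i : ℕ) : ℤ) - (m : ℤ) : ℤ) * θ : ℝ)) := by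
    intro θ
    have h1 : truncChar p K θ ^ n = ∏ _i : Fin n, truncChar p K θ := by simp
    rw [h1]
    simp only [truncChar]
    rw [Finset.prod_univ_sum, Finset.sum_mul]
    refine Finset.sum_congr rfl fun y _ => ?_
    rw [Finset.prod_mul_distrib, ← Complex.exp_sum, mul_assoc, ← Complex.exp_add]
    push_cast
    congr 2
    rw [← Finset.mul_sum, ← Finset.sum_mul]
    ring
  simp_rw [hexp]
  rw [intervalIntegral.integral_finsetSum]
  · simp_rw [intervalIntegral.integral_const_mul, integral_exp_int_mul]
    simp only [mul_ite, mul_zero]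
    rw [← Finset.sum_filter, truncCoeff]
    push_cast
    rw [Finset.mul_sum]
    refine Finset.sum_congr ?_ fun y _ => by ring
    ext y
    simp only [allocations, Finset.mem_filter, Finset.mem_piAntidiag, Fintype.mem_piFinset,
      Finset.mem_range, sub_eq_zero, Finset.mem_univ, implies_true, and_true, Nat.lt_succ_iff]
    rw [and_comm]
    norm_cast
  · intro y _
    apply Continuous.intervalIntegrable
    fun_prop

/-- A probability distribution `p` on `ℕ` with span `1`, positive mass at `0`, mean `lam` and
finite second moment. -/
structure LatticeLaw (p : ℕ → ℝ) (lam : ℝ) : Prop where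
  nonneg : ∀ k, 0 ≤ p k
  hasSum : HasSum p 1
  mean : HasSum (fun k : ℕ => k * p k) lam
  sq : Summable (fun k : ℕ => (k : ℝ) ^ 2 * p k)
  zero : 0 < p 0
  lam_pos : 0 < lam
  pos : ∃ l, 0 < p l ∧ 0 < p (l + 1)

/-- The tail sum `∑_{k > K} p_k`. -/
noncomputable def tailSum (p : ℕ → ℝ) (K : ℕ) : ℝ := ∑' k, p (k + (K + 1))

/-- The variance of `p`, given that the mean is `lam`. -/
noncomputable def latticeVar (p : ℕ → ℝ) (lam : ℝ) : ℝ := ∑' k : ℕ, p k * (k - lam) ^ 2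

/-! ### Asymptotics of the centred, truncated characteristic function -/

namespace LatticeLaw

variable {p : ℕ → ℝ} {lam : ℝ}

theorem summable_var (h : LatticeLaw p lam) : Summable fun k : ℕ => p k * ((k : ℝ) - lam) ^ 2 := by
  have := (h.sq.sub (h.mean.summable.mul_left (2 * lam))).add (h.hasSum.summable.mul_left (lam ^ 2))
  refine this.congr fun k => by ring

theorem var_pos (h : LatticeLaw p lam) : 0 < latticeVar p lam := by
  refine h.summable_var.tsum_pos (fun k => mul_nonneg (h.nonneg k) (sq_nonneg _)) 0 ?_
  have := h.zero
  have := h.lam_pos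
  simp only [Nat.cast_zero, zero_sub, neg_sq]
  positivity

theorem tailSum_nonneg (h : LatticeLaw p lam) (K : ℕ) : 0 ≤ tailSum p K :=
  tsum_nonneg fun _ => h.nonneg _

theorem summable_exp (h : LatticeLaw p lam) (f : ℕ → ℝ) :
    Summable fun k : ℕ => (p k : ℂ) * Complex.exp (Complex.I * (f k : ℂ)) := by
  refine Summable.of_norm ?_
  refine h.hasSum.summable.congr fun k => ?_
  rw [norm_mul, norm_exp_I_mul_ofReal', mul_one, Complex.norm_real, Real.norm_eq_abs,
    abs_of_nonneg (h.nonneg k)]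

/-- The linear term may be inserted freely because the centred mean is `0`. Moving the tail mass to
the left leaves a factor `exp (…) - 1` in the tail sum, which makes that sum negligible on the scale
`1 / n`. -/
theorem truncChar_mul_exp (h : LatticeLaw p lam) (K : ℕ) (θ : ℝ) :
    truncChar p K θ * Complex.exp (-(Complex.I * ((lam * θ : ℝ) : ℂ))) - 1 + (tailSum p K : ℂ) =
      ∑' k : ℕ, (p k : ℂ) * (Complex.exp (Complex.I * ((((k : ℝ) - lam) * θ : ℝ) : ℂ)) - 1 -
        Complex.I * ((((k : ℝ) - lam) * θ : ℝ) : ℂ)) -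
      ∑' k : ℕ, (p (k + (K + 1)) : ℂ) *
        (Complex.exp (Complex.I * (((((k + (K + 1) : ℕ) : ℝ) - lam) * θ : ℝ) : ℂ)) - 1) := by
  have hs : HasSum (fun k => (p k : ℂ)) 1 := by
    simpa using Complex.hasSum_ofReal.2 h.hasSum
  have hm : HasSum (fun k : ℕ => (p k : ℂ) * (Complex.I * ((((k : ℝ) - lam) * θ : ℝ) : ℂ))) 0 := by
    have h1 := Complex.hasSum_ofReal.2 ((h.mean.sub (h.hasSum.mul_left lam)).mul_right θ)
    have h2 := h1.mul_left Complex.I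
    simp only [mul_one, sub_self, zero_mul, Complex.ofReal_zero, mul_zero] at h2
    refine h2.congr_fun fun k => ?_
    push_cast
    ring
  have he := h.summable_exp fun k => ((k : ℝ) - lam) * θ
  have heK := (summable_nat_add_iff (K + 1)).2 he
  have hsK := (summable_nat_add_iff (K + 1)).2 hs.summable
  have htail : (tailSum p K : ℂ) = ∑' k, (p (k + (K + 1)) : ℂ) := by
    rw [tailSum, Complex.ofReal_tsum]
  have hsplit := he.sum_add_tsum_nat_add (K + 1)
  have htr : truncChar p K θ * Complex.exp (-(Complex.I * ((lam * θ : ℝ) : ℂ))) =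
      ∑ k ∈ Finset.range (K + 1),
        (p k : ℂ) * Complex.exp (Complex.I * ((((k : ℝ) - lam) * θ : ℝ) : ℂ)) := by
    rw [truncChar, Finset.sum_mul]
    refine Finset.sum_congr rfl fun k _ => ?_
    rw [mul_assoc, ← Complex.exp_add]
    congr 2
    push_cast
    ring
  simp_rw [mul_sub, mul_one]
  rw [(he.sub hs.summable).tsum_sub hm.summable, he.tsum_sub hs.summable, hm.tsum_eq, hs.tsum_eq,
    heK.tsum_sub hsK, ← htail, htr, ← hsplit]
  ring

/-- Dominated convergence over `k`: the global bound `norm_exp_I_mul_sub_one_sub_le` gives a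
variance series as majorant, the factor `n` cancelling against `(√n)^2`. -/
theorem tendsto_main_term (h : LatticeLaw p lam) (x : ℝ) :
    Tendsto (fun n : ℕ => (n : ℂ) * ∑' k : ℕ, (p k : ℂ) *
      (Complex.exp (Complex.I * ((((k : ℝ) - lam) * (x / √n) : ℝ) : ℂ)) - 1 -
        Complex.I * ((((k : ℝ) - lam) * (x / √n) : ℝ) : ℂ))) atTop
      (𝓝 ((-(latticeVar p lam / 2 * x ^ 2) : ℝ) : ℂ)) := by
  have hlim : ((-(latticeVar p lam / 2 * x ^ 2) : ℝ) : ℂ) =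
      ∑' k : ℕ, (p k : ℂ) * ((-((((k : ℝ) - lam) * x) ^ 2 / 2) : ℝ) : ℂ) := by
    have h1 := h.summable_var.hasSum.mul_right (-(x ^ 2 / 2))
    rw [← latticeVar] at h1
    have h2 := (Complex.hasSum_ofReal.2 h1).tsum_eq
    rw [show -(latticeVar p lam / 2 * x ^ 2) = latticeVar p lam * -(x ^ 2 / 2) by ring, ← h2]
    refine tsum_congr fun k => ?_
    push_cast
    ring
  rw [hlim]
  simp_rw [← tsum_mul_left]
  refine tendsto_tsum_of_dominated_convergence (bound := fun k : ℕ =>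
    2 * x ^ 2 * (p k * ((k : ℝ) - lam) ^ 2)) (h.summable_var.mul_left _) ?_ ?_
  · intro k
    have := (tendsto_mul_exp_sub_one_sub (((k : ℝ) - lam) * x)).const_mul (p k : ℂ)
    refine this.congr fun n => ?_
    rw [mul_div_assoc]
    ring
  · filter_upwards [eventually_gt_atTop 0] with n hn k
    have hn' : (0 : ℝ) < n := by exact_mod_cast hn
    rw [norm_mul, norm_mul, Complex.norm_natCast, Complex.norm_real, Real.norm_eq_abs,
      abs_of_nonneg (h.nonneg k)]
    have hb := norm_exp_I_mul_sub_one_sub_le (((k : ℝ) - lam) * (x / √n))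
    calc (n : ℝ) * (p k * _) ≤ n * (p k * (2 * (((k : ℝ) - lam) * (x / √n)) ^ 2)) := by
          gcongr
          exact h.nonneg k
      _ = 2 * x ^ 2 * (p k * ((k : ℝ) - lam) ^ 2) := by
          rw [mul_pow, div_pow, Real.sq_sqrt hn'.le]
          field_simp

theorem _root_.BallsInBoxes.tendsto_tail_var (p : ℕ → ℝ) (lam : ℝ) {K : ℕ → ℕ} (hK : Tendsto K atTop atTop) :
    Tendsto (fun n => ∑' k : ℕ, p (k + (K n + 1)) * (((k + (K n + 1) : ℕ) : ℝ) - lam) ^ 2)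
      atTop (𝓝 0) :=
  (tendsto_sum_nat_add fun k : ℕ => p k * ((k : ℝ) - lam) ^ 2).comp
    ((tendsto_add_atTop_nat 1).comp hK)

/-- Each term is at most `p_k √n |d x|` with `d = k - lam`. By AM-GM with weight `δ`, the sum is at
most `δ / 2` times the bounded `n * tailSum p (K n)`, plus a multiple of the vanishing tail of the
variance. -/
theorem tendsto_tail_term (h : LatticeLaw p lam) {K : ℕ → ℕ} (hK : Tendsto K atTop atTop) {C : ℝ}
    (hC : ∀ n : ℕ, n * tailSum p (K n) ≤ C) (x : ℝ) :
    Tendsto (fun n : ℕ => (n : ℂ) * ∑' k : ℕ, (p (k + (K n + 1)) : ℂ) *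
        (Complex.exp (Complex.I * (((((k + (K n + 1) : ℕ) : ℝ) - lam) * (x / √n) : ℝ) : ℂ)) - 1))
      atTop (𝓝 0) := by
  rw [Metric.tendsto_nhds]
  intro ε hε
  have hC0 : 0 ≤ C := by simpa using hC 0
  -- This makes `δ * C ≤ ε`; the `+ 1` covers `C = 0`.
  set δ := ε / (C + 1) with hδ
  have hδ0 : 0 < δ := by positivity
  have hT := tendsto_tail_var p lam hK
  have hT' := hT.mul_const (x ^ 2 / δ)
  rw [zero_mul] at hT'
  filter_upwards [hT'.eventually (gt_mem_nhds hε), eventually_gt_atTop 0] with n hn hn0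
  have hn' : (0 : ℝ) < n := by exact_mod_cast hn0
  have hspos : 0 < √(n : ℝ) := Real.sqrt_pos.2 hn'
  have hsq : √(n : ℝ) ^ 2 = n := Real.sq_sqrt hn'.le
  rw [dist_zero_right, ← tsum_mul_left]
  have hsum1 : HasSum (fun k => p (k + (K n + 1))) (tailSum p (K n)) :=
    ((summable_nat_add_iff (K n + 1)).2 h.hasSum.summable).hasSum
  have hsum2 := ((summable_nat_add_iff (K n + 1)).2 h.summable_var).hasSum
  set T := ∑' k : ℕ, p (k + (K n + 1)) * (((k + (K n + 1) : ℕ) : ℝ) - lam) ^ 2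
  have hdom := (hsum1.mul_left (δ * n / 2)).add (hsum2.mul_left (x ^ 2 / δ / 2))
  have hle := tsum_of_norm_bounded hdom (f := fun k : ℕ => (n : ℂ) * ((p (k + (K n + 1)) : ℂ) *
        (Complex.exp (Complex.I * (((((k + (K n + 1) : ℕ) : ℝ) - lam) * (x / √n) : ℝ) : ℂ)) - 1)))
    (fun k => by
      rw [norm_mul, norm_mul, Complex.norm_natCast, Complex.norm_real, Real.norm_eq_abs,
        abs_of_nonneg (h.nonneg _)]
      have hb := Real.norm_exp_I_mul_ofReal_sub_one_le
        (x := ((((k + (K n + 1) : ℕ) : ℝ) - lam) * (x / √n)))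
      set d := ((k + (K n + 1) : ℕ) : ℝ) - lam
      have hpk := h.nonneg (k + (K n + 1))
      set P := p (k + (K n + 1))
      calc (n : ℝ) * (P * _) ≤ n * (P * ‖d * (x / √n)‖) := by gcongr
        _ = P * (√n * |d * x|) := by
            rw [Real.norm_eq_abs, ← mul_div_assoc, abs_div, abs_of_pos hspos]
            nth_rw 1 [← hsq]
            field_simp
        _ ≤ P * (δ * n / 2 + x ^ 2 / δ / 2 * d ^ 2) := by
            gcongr
            have h1 : 0 ≤ (δ * √n - |d * x|) ^ 2 / (2 * δ) := by positivity
            have h2 : (δ * √n - |d * x|) ^ 2 / (2 * δ) =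
                δ * n / 2 + x ^ 2 / δ / 2 * d ^ 2 - √n * |d * x| := by
              rw [sub_sq, sq_abs, mul_pow, hsq]
              field_simp
              ring
            linarith
        _ = δ * n / 2 * P + x ^ 2 / δ / 2 * (P * d ^ 2) := by ring)
  refine hle.trans_lt ?_
  have h1 : δ * n / 2 * tailSum p (K n) ≤ δ * C / 2 := by
    have := mul_le_mul_of_nonneg_left (hC n) (show 0 ≤ δ / 2 by positivity)
    linarith
  have h2 : δ * C ≤ ε := by
    rw [hδ, div_mul_eq_mul_div, div_le_iff₀ (by positivity)]
    nlinarith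
  have h3 : x ^ 2 / δ / 2 * T = T * (x ^ 2 / δ) / 2 := by ring
  rw [h3]
  linarith

theorem tendsto_integrand (h : LatticeLaw p lam) {K m : ℕ → ℕ} (hK : Tendsto K atTop atTop) {C : ℝ}
    (hC : ∀ n : ℕ, n * tailSum p (K n) ≤ C)
    (hm : (fun n : ℕ => (m n : ℝ) - lam * n) =o[atTop] (fun n : ℕ => √(n : ℝ))) (x : ℝ) :
    Tendsto (fun n : ℕ => truncChar p (K n) (x / √n) ^ n *
      Complex.exp (-(Complex.I * ((m n * (x / √n) : ℝ) : ℂ))) *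
      Complex.exp ((n * tailSum p (K n) : ℝ) : ℂ)) atTop
      (𝓝 (Complex.exp ((-(latticeVar p lam / 2 * x ^ 2) : ℝ) : ℂ))) := by
  have h1 : Tendsto (fun n : ℕ => (n : ℂ) * (truncChar p (K n) (x / √n) *
      Complex.exp (-(Complex.I * ((lam * (x / √n) : ℝ) : ℂ))) - 1) +
      ((n * tailSum p (K n) : ℝ) : ℂ)) atTop
      (𝓝 ((-(latticeVar p lam / 2 * x ^ 2) : ℝ) : ℂ)) := by
    have := (h.tendsto_main_term x).sub (h.tendsto_tail_term hK hC x)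
    rw [sub_zero] at this
    refine this.congr fun n => ?_
    rw [← mul_sub, ← h.truncChar_mul_exp]
    push_cast
    ring
  have h2 := tendsto_pow_mul_exp (C := C) (fun n => by
    rw [abs_of_nonneg (mul_nonneg (Nat.cast_nonneg n) (h.tailSum_nonneg _))]
    exact hC n) h1
  -- Centring at `lam * n` instead of `m n` leaves a phase `(m n - lam n) x / √n`, which vanishes
  -- exactly because the deviation is `o(√n)`.
  have h3 : Tendsto (fun n : ℕ => Complex.exp (-(Complex.I *
      ((((m n - lam * n) / √n * x : ℝ)) : ℂ)))) atTop (𝓝 1) := by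
    have h4 := hm.tendsto_div_nhds_zero.mul_const x
    rw [zero_mul] at h4
    have h5 : Continuous fun y : ℝ => Complex.exp (-(Complex.I * (y : ℂ))) := by fun_prop
    have := (h5.tendsto 0).comp h4
    simpa only [Function.comp_def, Complex.ofReal_zero, mul_zero, neg_zero, Complex.exp_zero]
      using this
  have h6 := h2.mul h3
  rw [mul_one] at h6
  refine h6.congr fun n => ?_
  rw [mul_pow, ← Complex.exp_nat_mul]
  rw [mul_right_comm (_ * _), mul_assoc (_ ^ n), ← Complex.exp_add]
  congr 3
  push_cast
  ring

/-- The local limit theorem for sums of `n` independent variables with distribution `p`, on the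
event that none of them exceeds `K n`. -/
theorem tendsto_truncCoeff (h : LatticeLaw p lam) {K m : ℕ → ℕ} (hK : Tendsto K atTop atTop) {C : ℝ}
    (hC : ∀ n : ℕ, n * tailSum p (K n) ≤ C)
    (hm : (fun n : ℕ => (m n : ℝ) - lam * n) =o[atTop] (fun n : ℕ => √(n : ℝ))) :
    Tendsto (fun n : ℕ => √(n : ℝ) * (2 * Real.pi * truncCoeff p (K n) (m n) n) *
      Real.exp (n * tailSum p (K n))) atTop
      (𝓝 (∫ x : ℝ, Real.exp (-(latticeVar p lam / 2) * x ^ 2))) := by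
  obtain ⟨l, hl, hl'⟩ := h.pos
  obtain ⟨c, hc, hbound⟩ := exists_norm_truncChar_le h.nonneg h.hasSum hl hl'
  let F : ℕ → ℝ → ℂ := fun n x => truncChar p (K n) (x / √n) ^ n *
      Complex.exp (-(Complex.I * ((m n * (x / √n) : ℝ) : ℂ))) *
      Complex.exp ((n * tailSum p (K n) : ℝ) : ℂ)
  have hFc : ∀ n, Continuous (F n) := by
    intro n
    have := continuous_truncChar p (K n)
    fun_prop
  -- After `θ = x / √n` the domain grows with `n`; the indicator allows dominated convergence on the
  -- whole line.
  let S : ℕ → Set ℝ := fun n => Set.Ioc (-(Real.pi * √n)) (Real.pi * √n)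
  have key : Tendsto (fun n => ∫ x, (S n).indicator (F n) x) atTop
      (𝓝 (∫ x : ℝ, Complex.exp ((-(latticeVar p lam / 2 * x ^ 2) : ℝ) : ℂ))) := by
    refine tendsto_integral_filter_of_dominated_convergence
      (fun x => Real.exp C * Real.exp (-c * x ^ 2)) ?_ ?_ ?_ ?_
    · exact Eventually.of_forall fun n =>
        ((hFc n).aestronglyMeasurable).indicator measurableSet_Ioc
    · filter_upwards [hK.eventually_ge_atTop (l + 1), eventually_gt_atTop 0] with n hn hn0
      refine Eventually.of_forall fun x => ?_
      have hn' : (0 : ℝ) < n := by exact_mod_cast hn0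
      have hspos : 0 < √(n : ℝ) := Real.sqrt_pos.2 hn'
      by_cases hx : x ∈ S n
      · rw [Set.indicator_of_mem hx]
        have hxa : |x / √n| ≤ Real.pi := by
          rw [abs_div, abs_of_pos hspos, div_le_iff₀ hspos, abs_le]
          exact ⟨hx.1.le, hx.2⟩
        have hb := hbound (K n) hn (x / √n) hxa
        have e1 : ‖Complex.exp (-(Complex.I * ((m n * (x / √n) : ℝ) : ℂ)))‖ = 1 := by
          rw [← mul_neg, ← Complex.ofReal_neg, norm_exp_I_mul_ofReal']
        have e2 : ‖Complex.exp ((n * tailSum p (K n) : ℝ) : ℂ)‖ = Real.exp (n * tailSum p (K n)) := by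
          rw [← Complex.ofReal_exp, Complex.norm_real, Real.norm_eq_abs, Real.abs_exp]
        simp only [F]
        rw [norm_mul, norm_mul, e1, e2, mul_one, norm_pow, mul_comm]
        refine mul_le_mul (Real.exp_le_exp.2 (hC n)) ?_ (by positivity) (by positivity)
        calc _ ≤ Real.exp (-(c * (x / √n) ^ 2)) ^ n := by gcongr
          _ = Real.exp (-c * x ^ 2) := by
            rw [← Real.exp_nat_mul, div_pow, Real.sq_sqrt hn'.le]
            congr 1
            field_simp
      · rw [Set.indicator_of_notMem hx, norm_zero]
        positivity
    · exact (integrable_exp_neg_mul_sq hc).const_mul _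
    · refine Eventually.of_forall fun x => ?_
      refine (h.tendsto_integrand hK hC hm x).congr' ?_
      have hs : Tendsto (fun n : ℕ => Real.pi * √(n : ℝ)) atTop atTop :=
        (Real.tendsto_sqrt_atTop.comp tendsto_natCast_atTop_atTop).const_mul_atTop Real.pi_pos
      filter_upwards [hs.eventually_gt_atTop |x|] with n hn
      rw [Set.indicator_of_mem]
      have := abs_lt.1 hn
      exact ⟨this.1, this.2.le⟩
  have hre : ∀ᶠ n : ℕ in atTop, ∫ x, (S n).indicator (F n) x =
      ((√(n : ℝ) * (2 * Real.pi * truncCoeff p (K n) (m n) n) *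
        Real.exp (n * tailSum p (K n)) : ℝ) : ℂ) := by
    filter_upwards [eventually_gt_atTop 0] with n hn0
    have hn' : (0 : ℝ) < n := by exact_mod_cast hn0
    have hspos : 0 < √(n : ℝ) := Real.sqrt_pos.2 hn'
    have hpi := Real.pi_pos
    rw [integral_indicator measurableSet_Ioc, ← intervalIntegral.integral_of_le (by
      have : 0 < Real.pi * √(n : ℝ) := by positivity
      linarith)]
    simp only [F]
    rw [intervalIntegral.integral_mul_const]
    rw [intervalIntegral.integral_comp_div (fun θ : ℝ => truncChar p (K n) θ ^ n *
      Complex.exp (-(Complex.I * ((m n * θ : ℝ) : ℂ)))) hspos.ne']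
    rw [neg_div, mul_div_cancel_right₀ _ hspos.ne', ← truncCoeff_eq_integral,
      Complex.real_smul, ← Complex.ofReal_exp]
    push_cast
    ring
  have hlim : ∫ x : ℝ, Complex.exp ((-(latticeVar p lam / 2 * x ^ 2) : ℝ) : ℂ) =
      ((∫ x : ℝ, Real.exp (-(latticeVar p lam / 2) * x ^ 2) : ℝ) : ℂ) := by
    rw [← integral_complex_ofReal]
    simp_rw [Complex.ofReal_exp, neg_mul]
  rw [hlim] at key
  have := (Complex.continuous_re.tendsto _).comp (key.congr' hre)
  simpa only [Function.comp_def, Complex.ofReal_re] using this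

end LatticeLaw

/-! ### The quotient of truncated and untruncated coefficients -/

namespace LatticeLaw

variable {p : ℕ → ℝ} {lam : ℝ}

theorem tendsto_balls (h : LatticeLaw p lam) {m : ℕ → ℕ}
    (hm : (fun n : ℕ => (m n : ℝ) - lam * n) =o[atTop] (fun n : ℕ => √(n : ℝ))) :
    ∀ᶠ n : ℕ in atTop, lam / 2 * n ≤ m n := by
  have hlam := h.lam_pos
  filter_upwards [hm.bound (half_pos hlam), eventually_gt_atTop 0] with n hn hn0
  have hn1 : (1 : ℝ) ≤ n := by exact_mod_cast hn0
  have hs : √(n : ℝ) ≤ n := by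
    rw [Real.sqrt_le_left (by positivity)]
    nlinarith
  rw [Real.norm_eq_abs, Real.norm_eq_abs, abs_of_nonneg (Real.sqrt_nonneg _)] at hn
  have h1 := (abs_le.1 hn).1
  have h2 : lam / 2 * √(n : ℝ) ≤ lam / 2 * n := by gcongr
  linarith

theorem tendsto_balls_atTop (h : LatticeLaw p lam) {m : ℕ → ℕ}
    (hm : (fun n : ℕ => (m n : ℝ) - lam * n) =o[atTop] (fun n : ℕ => √(n : ℝ))) :
    Tendsto m atTop atTop := by
  rw [← tendsto_natCast_atTop_iff (R := ℝ)]
  exact tendsto_atTop_mono' _ (h.tendsto_balls hm)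
    (tendsto_natCast_atTop_atTop.const_mul_atTop (half_pos h.lam_pos))

/-- Chebyshev's argument: `k > m n ≥ lam n / 2` gives `n ≤ 4 k^2 / lam^2`, so the second-moment tail
dominates. Truncation at `m n`, which is no restriction when the sum is `m n`, thus costs a factor
tending to `1`. -/
theorem tendsto_mul_tailSum_balls (h : LatticeLaw p lam) {m : ℕ → ℕ}
    (hm : (fun n : ℕ => (m n : ℝ) - lam * n) =o[atTop] (fun n : ℕ => √(n : ℝ))) :
    Tendsto (fun n : ℕ => n * tailSum p (m n)) atTop (𝓝 0) := by
  have hlam := h.lam_pos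
  have hT := (tendsto_tail_var p 0 (h.tendsto_balls_atTop hm)).mul_const (4 / lam ^ 2)
  rw [zero_mul] at hT
  refine squeeze_zero' (Eventually.of_forall fun n =>
    mul_nonneg (Nat.cast_nonneg n) (h.tailSum_nonneg _)) ?_ hT
  filter_upwards [h.tendsto_balls hm, eventually_gt_atTop 0] with n hn hn0
  have hn1 : (1 : ℝ) ≤ n := by exact_mod_cast hn0
  have hn' : (0 : ℝ) < n := by linarith
  have hsq : Summable fun k : ℕ => p k * ((k : ℝ) - 0) ^ 2 :=
    h.sq.congr fun k => by ring
  have hsum2 := (summable_nat_add_iff (m n + 1)).2 hsq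
  rw [tailSum, ← tsum_mul_left, ← tsum_mul_right]
  refine ((summable_nat_add_iff (m n + 1)).2 h.hasSum.summable |>.mul_left _).tsum_le_tsum
    (fun k => ?_) (hsum2.mul_right _)
  have hk : lam / 2 * n ≤ ((k + (m n + 1) : ℕ) : ℝ) := by
    push_cast
    have : (0 : ℝ) ≤ k := Nat.cast_nonneg k
    linarith
  have hp := h.nonneg (k + (m n + 1))
  set d := ((k + (m n + 1) : ℕ) : ℝ)
  have h1 : (lam / 2 * n) ^ 2 ≤ d ^ 2 := by gcongr
  have h2 : (n : ℝ) ≤ d ^ 2 * (4 / lam ^ 2) := by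
    rw [mul_div_assoc', le_div_iff₀ (by positivity)]
    nlinarith [mul_le_mul_of_nonneg_left hn1 (show 0 ≤ lam ^ 2 * n by positivity)]
  rw [sub_zero, mul_comm, mul_assoc]
  gcongr

theorem integral_pos (h : LatticeLaw p lam) :
    0 < ∫ x : ℝ, Real.exp (-(latticeVar p lam / 2) * x ^ 2) := by
  have := h.var_pos
  rw [integral_gaussian]
  positivity

theorem eventually_truncCoeff_pos (h : LatticeLaw p lam) {m : ℕ → ℕ}
    (hm : (fun n : ℕ => (m n : ℝ) - lam * n) =o[atTop] (fun n : ℕ => √(n : ℝ))) :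
    ∀ᶠ n in atTop, 0 < truncCoeff p (m n) (m n) n := by
  obtain ⟨C, hC⟩ := (h.tendsto_mul_tailSum_balls hm).bddAbove_range
  have hlim := h.tendsto_truncCoeff (h.tendsto_balls_atTop hm) (C := C)
    (fun n => hC (Set.mem_range_self n)) hm
  filter_upwards [hlim.eventually (lt_mem_nhds h.integral_pos)] with n hn
  by_contra hcon
  rw [not_lt] at hcon
  have hpi := Real.pi_pos
  have : √(n : ℝ) * (2 * Real.pi * truncCoeff p (m n) (m n) n) *
      Real.exp (n * tailSum p (m n)) ≤ 0 :=
    mul_nonpos_of_nonpos_of_nonneg (mul_nonpos_of_nonneg_of_nonpos (Real.sqrt_nonneg _)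
      (mul_nonpos_of_nonneg_of_nonpos (by positivity) hcon)) (Real.exp_pos _).le
  linarith

/-- Both coefficients have the same positive Gaussian limit, so `√n` and the variance cancel. As `n
* tailSum p (K n)` need not converge, the conclusion is about a difference. -/
theorem tendsto_truncCoeff_div (h : LatticeLaw p lam) {K m : ℕ → ℕ} (hK : Tendsto K atTop atTop)
    {C : ℝ} (hC : ∀ n : ℕ, n * tailSum p (K n) ≤ C)
    (hm : (fun n : ℕ => (m n : ℝ) - lam * n) =o[atTop] (fun n : ℕ => √(n : ℝ))) :
    Tendsto (fun n : ℕ => truncCoeff p (K n) (m n) n / truncCoeff p (m n) (m n) n -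
      Real.exp (-(n * tailSum p (K n)))) atTop (𝓝 0) := by
  have h0 := h.tendsto_mul_tailSum_balls hm
  obtain ⟨C', hC'⟩ := h0.bddAbove_range
  have h1 := h.tendsto_truncCoeff hK hC hm
  have h2 := h.tendsto_truncCoeff (h.tendsto_balls_atTop hm) (C := C')
    (fun n => hC' (Set.mem_range_self n)) hm
  have hI := h.integral_pos
  have h3 := ((h1.div h2 hI.ne').mul (Real.continuous_exp.tendsto 0 |>.comp h0)).sub_const 1
  rw [div_self hI.ne', Real.exp_zero, mul_one, sub_self] at h3
  have h4 : Tendsto (fun n : ℕ => Real.exp (-(n * tailSum p (K n))) *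
      (((√(n : ℝ) * (2 * Real.pi * truncCoeff p (K n) (m n) n) *
      Real.exp (n * tailSum p (K n))) / (√(n : ℝ) * (2 * Real.pi * truncCoeff p (m n) (m n) n) *
      Real.exp (n * tailSum p (m n)))) * Real.exp (n * tailSum p (m n)) - 1)) atTop (𝓝 0) := by
    refine isBoundedUnder_le_mul_tendsto_zero ?_ h3
    refine isBoundedUnder_of ⟨1, fun n => ?_⟩
    have := mul_nonneg (Nat.cast_nonneg (α := ℝ) n) (h.tailSum_nonneg (K n))
    simpa using this
  refine h4.congr' ?_
  filter_upwards [h.eventually_truncCoeff_pos hm, eventually_gt_atTop 0] with n hn hn0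
  have hn' : (0 : ℝ) < n := by exact_mod_cast hn0
  have hspos : 0 < √(n : ℝ) := Real.sqrt_pos.2 hn'
  rw [Real.exp_neg]
  have := Real.pi_pos
  field_simp

end LatticeLaw

/-! ### The maximal occupancy in terms of truncated partition functions -/

/-- The factor `t ^ (∑ i, y i) = t ^ m` is common to all allocations, so tilting cancels in every
quotient of coefficients. -/
theorem truncCoeff_tilt (w : ℕ → ℝ) (t s : ℝ) (K m n : ℕ) :
    truncCoeff (fun k => w k * t ^ k / s) K m n = t ^ m / s ^ n * truncCoeff w K m n := by
  rw [truncCoeff, truncCoeff, Finset.mul_sum]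
  refine Finset.sum_congr rfl fun y hy => ?_
  have hy' : ∑ i, y i = m := by
    have := (Finset.mem_filter.1 hy).1
    simpa [allocations] using this
  rw [Finset.prod_div_distrib, Finset.prod_mul_distrib, Finset.prod_pow_eq_pow_sum, hy',
    Finset.prod_const, Finset.card_univ, Fintype.card_fin]
  ring

theorem coe_partitionFun (w : ℕ → ℝ≥0) (m n : ℕ) :
    (partitionFun w m n : ℝ) = truncCoeff (fun k => (w k : ℝ)) m m n := by
  rw [truncCoeff, Finset.filter_true_of_mem, partitionFun]
  · simp [weight]
  · intro y hy i
    have hy' : ∑ i, y i = m := by simpa [allocations] using hy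
    rw [← hy']
    exact Finset.single_le_sum (fun _ _ => Nat.zero_le _) (Finset.mem_univ i)

theorem maxOccupancy_real_Iic (w : ℕ → ℝ≥0) {m n : ℕ} (hZ : partitionFun w m n ≠ 0) (K : ℕ) :
    (maxOccupancy w m n).toMeasure.real (Set.Iic (K : ℤ)) =
      truncCoeff (fun k => (w k : ℝ)) K m n / partitionFun w m n := by
  classical
  rw [measureReal_def, PMF.toMeasure_apply_eq_toOuterMeasure_apply _ measurableSet_Iic,
    maxOccupancy, PMF.toOuterMeasure_map_apply, randomAllocation, dif_neg hZ,
    PMF.toOuterMeasure_ofFinset_apply]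
  rw [tsum_eq_sum (s := (allocations m n).filter (fun y => ∀ i, y i ≤ K))]
  · have : ∀ y ∈ (allocations m n).filter (fun y => ∀ i, y i ≤ K),
        ((fun y : Fin n → ℕ => ((Finset.univ.sup y : ℕ) : ℤ)) ⁻¹' Set.Iic (K : ℤ)).indicator
          (fun y => if y ∈ allocations m n then
            ((weight w y / partitionFun w m n : ℝ≥0) : ℝ≥0∞) else 0) y =
          ((weight w y / partitionFun w m n : ℝ≥0) : ℝ≥0∞) := by
      intro y hy
      rw [Finset.mem_filter] at hy
      rw [Set.indicator_of_mem, if_pos hy.1]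
      simpa using hy.2
    rw [Finset.sum_congr rfl this, ← ENNReal.ofNNReal_finsetSum, ENNReal.coe_toReal,
      ← Finset.sum_div, truncCoeff]
    simp [weight]
  · intro y hy
    rw [Finset.mem_filter, not_and] at hy
    by_cases hy1 : y ∈ allocations m n
    · rw [Set.indicator_of_notMem]
      simpa using hy hy1
    · simp [Set.indicator, hy1]

/-! ### Laws on `ℤ` with asymptotically Gumbel distribution functions -/

/-- The laws `μ n`, shifted by `κ n`, have asymptotically the distribution functions
`j ↦ exp (-B n q ^ (j + 1))`. -/
def HasGumbelCDF (q : ℝ) (B : ℕ → ℝ) (κ : ℕ → ℤ) (μ : ℕ → Measure ℤ) : Prop :=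
  ∀ j : ℤ, Tendsto (fun n => (μ n).real (Set.Iic (κ n + j)) - Real.exp (-(B n * q ^ (j + 1))))
    atTop (𝓝 0)

section

variable {q : ℝ} {B : ℕ → ℝ} {κ : ℕ → ℤ} {μ ν : ℕ → Measure ℤ}

theorem real_Ioc_int (μ : Measure ℤ) [IsFiniteMeasure μ] {a b : ℤ} (hab : a ≤ b) :
    μ.real (Set.Ioc a b) = μ.real (Set.Iic b) - μ.real (Set.Iic a) := by
  rw [← Set.Iic_sdiff_Iic, measureReal_sdiff (Set.Iic_subset_Iic.2 hab) measurableSet_Iic]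

theorem real_singleton_int (μ : Measure ℤ) [IsFiniteMeasure μ] (a : ℤ) :
    μ.real {a} = μ.real (Set.Iic a) - μ.real (Set.Iic (a - 1)) := by
  rw [← real_Ioc_int μ (by omega)]
  congr 1
  ext x
  simp only [Set.mem_singleton_iff, Set.mem_Ioc]
  omega

/-- Source of all tightness: by monotonicity in `B`, these endpoint estimates control both tails
uniformly for `B ∈ [c, C]`. -/
theorem exists_exp_bounds (hq0 : 0 < q) (hq1 : q < 1) {c C : ℝ} (hc : 0 < c)
    {ε : ℝ} (hε : 0 < ε) : ∃ J : ℕ, Real.exp (-(c * q ^ (-(J : ℤ) + 1))) < ε ∧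
      1 - ε < Real.exp (-(C * q ^ ((J : ℤ) + 1))) := by
  have h1 : Tendsto (fun J : ℕ => Real.exp (-(c * q * (q⁻¹) ^ J))) atTop (𝓝 0) :=
    Real.tendsto_exp_atBot.comp (tendsto_neg_atTop_atBot.comp
      ((tendsto_pow_atTop_atTop_of_one_lt (one_lt_inv₀ hq0 |>.2 hq1)).const_mul_atTop
        (mul_pos hc hq0)))
  have h2 : Tendsto (fun J : ℕ => Real.exp (-(C * q * q ^ J))) atTop (𝓝 1) := by
    have := ((tendsto_pow_atTop_nhds_zero_of_lt_one hq0.le hq1).const_mul (C * q)).neg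
    rw [mul_zero, neg_zero] at this
    have h := (Real.continuous_exp.tendsto 0).comp this
    rw [Real.exp_zero] at h
    exact h
  obtain ⟨J, hJ1, hJ2⟩ := ((h1.eventually (gt_mem_nhds hε)).and
    (h2.eventually (lt_mem_nhds (show 1 - ε < 1 by linarith)))).exists
  refine ⟨J, ?_, ?_⟩
  · rwa [zpow_add₀ hq0.ne', zpow_neg, zpow_natCast, zpow_one, ← inv_pow, mul_comm (_ ^ J),
      ← mul_assoc]
  · rwa [zpow_add₀ hq0.ne', zpow_natCast, zpow_one, mul_comm (_ ^ J), ← mul_assoc]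

theorem HasGumbelCDF.exists_real_Ioc_gt [∀ n, IsProbabilityMeasure (μ n)]
    (h : HasGumbelCDF q B κ μ) (hq0 : 0 < q) (hq1 : q < 1) {c C : ℝ} (hc : 0 < c)
    (hB : ∀ᶠ n in atTop, c ≤ B n ∧ B n ≤ C) {ε : ℝ} (hε : 0 < ε) :
    ∃ J : ℕ, ∀ J' : ℕ, J ≤ J' → ∀ᶠ n in atTop,
      1 - ε < (μ n).real (Set.Ioc (κ n + -J') (κ n + J')) := by
  obtain ⟨J, hJ1, hJ2⟩ := exists_exp_bounds hq0 hq1 (C := C) hc (show 0 < ε / 4 by positivity)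
  refine ⟨J, fun J' hJ' => ?_⟩
  filter_upwards [hB, (h (-J)).eventually (gt_mem_nhds (show 0 < ε / 4 by positivity)),
    (h J).eventually (lt_mem_nhds (show -(ε / 4) < 0 by linarith))] with n hn h1 h2
  have hmono : (μ n).real (Set.Ioc (κ n + -J) (κ n + J)) ≤
      (μ n).real (Set.Ioc (κ n + -J') (κ n + J')) :=
    measureReal_mono (Set.Ioc_subset_Ioc (by omega) (by omega))
  rw [real_Ioc_int _ (by omega)] at hmono
  have h3 : Real.exp (-(B n * q ^ (-(J : ℤ) + 1))) ≤ Real.exp (-(c * q ^ (-(J : ℤ) + 1))) := by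
    gcongr
    exact hn.1
  have h4 : Real.exp (-(C * q ^ ((J : ℤ) + 1))) ≤ Real.exp (-(B n * q ^ ((J : ℤ) + 1))) := by
    gcongr
    exact hn.2
  linarith

theorem HasGumbelCDF.tendsto_singleton_sub [∀ n, IsFiniteMeasure (μ n)]
    [∀ n, IsFiniteMeasure (ν n)] (hμ : HasGumbelCDF q B κ μ) (hν : HasGumbelCDF q B κ ν) (j : ℤ) :
    Tendsto (fun n => (μ n).real {κ n + j} - (ν n).real {κ n + j}) atTop (𝓝 0) := by
  have := ((hμ j).sub (hμ (j - 1))).sub ((hν j).sub (hν (j - 1)))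
  simp only [sub_zero] at this
  refine this.congr fun n => ?_
  rw [real_singleton_int (μ n), real_singleton_int (ν n), ← add_sub_assoc]
  ring

/-- Atoms are compared inside `D`, and outside only the missing masses count. The bound does not
depend on `A`, so it controls the total variation. -/
theorem abs_real_sub_le (μ ν : Measure ℤ) [IsProbabilityMeasure μ] [IsProbabilityMeasure ν]
    (A : Set ℤ) (D : Finset ℤ) :
    |μ.real A - ν.real A| ≤ ∑ x ∈ D, |μ.real {x} - ν.real {x}| + (1 - μ.real D) +
      (1 - ν.real D) := by
  classical
  have hA : ∀ ξ : Measure ℤ, IsProbabilityMeasure ξ →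
      ∑ x ∈ D with x ∈ A, ξ.real {x} ≤ ξ.real A ∧
      ξ.real A ≤ ∑ x ∈ D with x ∈ A, ξ.real {x} + (1 - ξ.real D) := by
    intro ξ _
    have h1 : ∑ x ∈ D with x ∈ A, ξ.real {x} = ξ.real (A ∩ D) := by
      rw [sum_measureReal_singleton]
      congr 1
      ext x
      simp [and_comm]
    have h2 : ξ.real A = ξ.real (A ∩ D) + ξ.real (A \ D) :=
      (measureReal_inter_add_sdiff D.measurableSet).symm
    have h3 : ξ.real (A \ D) ≤ 1 - ξ.real D := by
      rw [← probReal_compl_eq_one_sub D.measurableSet]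
      exact measureReal_mono fun x hx => hx.2
    have h4 : 0 ≤ ξ.real (A \ D) := measureReal_nonneg
    rw [h1]
    constructor <;> linarith
  obtain ⟨hμ1, hμ2⟩ := hA μ inferInstance
  obtain ⟨hν1, hν2⟩ := hA ν inferInstance
  have hsum : |∑ x ∈ D with x ∈ A, μ.real {x} - ∑ x ∈ D with x ∈ A, ν.real {x}| ≤
      ∑ x ∈ D, |μ.real {x} - ν.real {x}| := by
    rw [← Finset.sum_sub_distrib]
    refine (Finset.abs_sum_le_sum_abs _ _).trans ?_
    exact Finset.sum_le_sum_of_subset_of_nonneg (Finset.filter_subset _ _)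
      fun _ _ _ => abs_nonneg _
  have h1 : μ.real D ≤ 1 := measureReal_le_one
  have h2 : ν.real D ≤ 1 := measureReal_le_one
  rw [abs_le] at hsum ⊢
  constructor <;> linarith [hsum.1, hsum.2]

/-- A fixed finite window around `κ n` carries almost all mass of both laws, and each of its atoms
has asymptotically equal masses. Two missing masses and the sum over atoms contribute `ε / 4` each.
-/
theorem HasGumbelCDF.dApprox [∀ n, IsProbabilityMeasure (μ n)] [∀ n, IsProbabilityMeasure (ν n)]
    (hμ : HasGumbelCDF q B κ μ) (hν : HasGumbelCDF q B κ ν) (hq0 : 0 < q) (hq1 : q < 1) {c C : ℝ}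
    (hc : 0 < c) (hB : ∀ᶠ n in atTop, c ≤ B n ∧ B n ≤ C) : DApprox μ ν := by
  rw [DApprox, Metric.tendsto_nhds]
  intro ε hε
  obtain ⟨J₁, hJ₁⟩ := hμ.exists_real_Ioc_gt hq0 hq1 hc hB (show 0 < ε / 4 by positivity)
  obtain ⟨J₂, hJ₂⟩ := hν.exists_real_Ioc_gt hq0 hq1 hc hB (show 0 < ε / 4 by positivity)
  set J := max J₁ J₂
  have hsum : Tendsto (fun n => ∑ j ∈ Finset.Ioc (-(J : ℤ)) J,
      |(μ n).real {κ n + j} - (ν n).real {κ n + j}|) atTop (𝓝 0) := by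
    have := tendsto_finsetSum (Finset.Ioc (-(J : ℤ)) J)
      fun j _ => (hμ.tendsto_singleton_sub hν j).abs
    simpa using this
  filter_upwards [hJ₁ J (le_max_left _ _), hJ₂ J (le_max_right _ _),
    hsum.eventually (gt_mem_nhds (show 0 < ε / 4 by positivity))] with n h1 h2 h3
  have hbd : ∀ A : {A : Set ℤ // MeasurableSet A},
      |(μ n).real (A : Set ℤ) - (ν n).real (A : Set ℤ)| ≤ 3 * ε / 4 := by
    intro A
    have := abs_real_sub_le (μ n) (ν n) A (Finset.Ioc (κ n + -J) (κ n + J))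
    rw [← Finset.image_add_left_Ioc, Finset.sum_image (fun x _ y _ h => by simpa using h)] at this
    rw [Finset.image_add_left_Ioc, Finset.coe_Ioc] at this
    linarith
  have hle : tvDist (μ n) (ν n) ≤ 3 * ε / 4 :=
    have : Nonempty {A : Set ℤ // MeasurableSet A} := ⟨⟨∅, MeasurableSet.empty⟩⟩
    ciSup_le hbd
  have h0 : 0 ≤ tvDist (μ n) (ν n) := Real.iSup_nonneg fun _ => abs_nonneg _
  rw [Real.dist_0_eq_abs, abs_of_nonneg h0]
  linarith

theorem abs_real_sub_le_tvDist (μ ν : Measure ℤ) [IsProbabilityMeasure μ] [IsProbabilityMeasure ν]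
    {A : Set ℤ} (hA : MeasurableSet A) : |μ.real A - ν.real A| ≤ tvDist μ ν := by
  refine le_ciSup (f := fun A : {A : Set ℤ // MeasurableSet A} =>
    |μ.real (A : Set ℤ) - ν.real (A : Set ℤ)|) ⟨1, ?_⟩ ⟨A, hA⟩
  rintro _ ⟨A, rfl⟩
  have h1 : μ.real (A : Set ℤ) ≤ 1 := measureReal_le_one
  have h2 : ν.real (A : Set ℤ) ≤ 1 := measureReal_le_one
  have h3 : 0 ≤ μ.real (A : Set ℤ) := measureReal_nonneg
  have h4 : 0 ≤ ν.real (A : Set ℤ) := measureReal_nonneg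
  rw [abs_le]
  constructor <;> linarith

theorem tendsto_of_dApprox {P : ℕ → ProbabilityMeasure ℤ} {L : ProbabilityMeasure ℤ}
    (h : DApprox (fun n => (P n : Measure ℤ)) (fun _ => (L : Measure ℤ))) :
    Tendsto P atTop (𝓝 L) := by
  refine tendsto_of_forall_isOpen_le_liminf' fun G _ => ?_
  have hreal : Tendsto (fun n => (P n : Measure ℤ).real G) atTop (𝓝 ((L : Measure ℤ).real G)) := by
    rw [tendsto_iff_norm_sub_tendsto_zero]
    exact squeeze_zero (fun _ => norm_nonneg _)
      (fun n => abs_real_sub_le_tvDist _ _ (MeasurableSet.of_discrete)) h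
  have := (ENNReal.tendsto_toReal_iff (fun _ => measure_ne_top _ _) (measure_ne_top _ _)).1 hreal
  exact this.liminf_eq.ge

/-- One window serves all large `n`; the finitely many remaining laws are individually tight, and a
finite union of compact sets is compact. -/
theorem HasGumbelCDF.isTightMeasureSet [∀ n, IsProbabilityMeasure (μ n)]
    (h : HasGumbelCDF q B 0 μ) (hq0 : 0 < q) (hq1 : q < 1) {c C : ℝ} (hc : 0 < c)
    (hB : ∀ᶠ n in atTop, c ≤ B n ∧ B n ≤ C) : IsTightMeasureSet (Set.range μ) := by
  rw [isTightMeasureSet_iff_exists_isCompact_measure_compl_le]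
  intro ε hε
  obtain ⟨δ, hδ0, hδ⟩ := ENNReal.lt_iff_exists_nnreal_btwn.1 hε
  obtain ⟨J, hJ⟩ := h.exists_real_Ioc_gt hq0 hq1 hc hB
    (show 0 < (δ : ℝ) by exact_mod_cast hδ0)
  obtain ⟨N, hN⟩ := eventually_atTop.1 (hJ J le_rfl)
  have hsing : ∀ n, ∃ K : Set ℤ, IsCompact K ∧ μ n Kᶜ ≤ ε := fun n => by
    obtain ⟨K, hK, hK'⟩ := isTightMeasureSet_iff_exists_isCompact_measure_compl_le.1
      (isTightMeasureSet_singleton (μ := μ n)) ε hε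
    exact ⟨K, hK, hK' _ rfl⟩
  choose K hK hK' using hsing
  refine ⟨Set.Ioc (-(J : ℤ)) J ∪ ⋃ n ∈ Finset.range N, K n, ?_, ?_⟩
  · exact (Set.finite_Ioc _ _).isCompact.union
      ((Finset.range N).isCompact_biUnion fun n _ => hK n)
  · rintro _ ⟨n, rfl⟩
    rcases lt_or_ge n N with hn | hn
    · refine (measure_mono ?_).trans (hK' n)
      refine Set.compl_subset_compl.2 (Set.subset_union_of_subset_right ?_ _)
      exact Set.subset_biUnion_of_mem (u := K) (Finset.mem_coe.2 (Finset.mem_range.2 hn))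
    · refine (measure_mono (Set.compl_subset_compl.2 Set.subset_union_left)).trans ?_
      have h1 := hN n hn
      simp only [Pi.zero_apply, zero_add] at h1
      have h2 : (μ n).real (Set.Ioc (-(J : ℤ)) J)ᶜ ≤ δ := by
        rw [probReal_compl_eq_one_sub measurableSet_Ioc]
        linarith
      rw [measureReal_def] at h2
      refine le_trans ?_ hδ.le
      rw [← ENNReal.ofReal_toReal (measure_ne_top (μ n) _), ← ENNReal.ofReal_coe_nnreal]
      exact ENNReal.ofReal_le_ofReal h2

theorem HasGumbelCDF.comp (h : HasGumbelCDF q B κ μ) {φ : ℕ → ℕ} (hφ : StrictMono φ) :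
    HasGumbelCDF q (fun n => B (φ n)) (fun n => κ (φ n)) (fun n => μ (φ n)) :=
  fun j => (h j).comp hφ.tendsto_atTop

theorem HasGumbelCDF.const {b : ℝ} {L : Measure ℤ} (hB : Tendsto B atTop (𝓝 b))
    (hL : ∀ j : ℤ, L.real (Set.Iic j) = Real.exp (-(b * q ^ (j + 1)))) :
    HasGumbelCDF q B 0 (fun _ => L) := by
  intro j
  have : Continuous fun x : ℝ => Real.exp (-(b * q ^ (j + 1))) - Real.exp (-(x * q ^ (j + 1))) := by
    fun_prop
  have := (this.tendsto b).comp hB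
  simpa [hL, Function.comp_def] using this

/-- At `j = -1` the power of `q` is `1`, so the distribution function itself is `exp (-B n) + o(1)`.
The upper bound on `B` keeps its limit positive, and `B` is recovered by a logarithm. -/
theorem HasGumbelCDF.exists_tendsto {P : ℕ → ProbabilityMeasure ℤ} {L : ProbabilityMeasure ℤ}
    (h : HasGumbelCDF q B 0 fun n => (P n : Measure ℤ)) (hL : Tendsto P atTop (𝓝 L))
    {C : ℝ} (hB : ∀ᶠ n in atTop, B n ≤ C) :
    ∃ b, Tendsto B atTop (𝓝 b) := by
  have h1 : Tendsto (fun n => (P n : Measure ℤ).real (Set.Iic (-1))) atTop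
      (𝓝 ((L : Measure ℤ).real (Set.Iic (-1)))) := by
    have h2 := ProbabilityMeasure.tendsto_measure_of_null_frontier_of_tendsto hL
      (E := Set.Iic (-1)) (by simp)
    exact (NNReal.continuous_coe.tendsto _).comp h2
  have h3 := h1.sub (h (-1))
  simp only [Pi.zero_apply, zero_add, sub_sub_cancel, neg_add_cancel, zpow_zero, mul_one,
    sub_zero] at h3
  have hpos : Real.exp (-C) ≤ (L : Measure ℤ).real (Set.Iic (-1)) := by
    refine ge_of_tendsto h3 ?_
    filter_upwards [hB] with n hn
    gcongr
  have h4 := (h3.log ((Real.exp_pos _).trans_le hpos).ne').neg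
  simp only [Real.log_exp, neg_neg] at h4
  exact ⟨_, h4⟩

end

/-! ### The Gumbel distribution and maxima of geometric variables -/

theorem gumbel_real_Iio (x : ℝ) : gumbel.real (Set.Iio x) = Real.exp (-Real.exp (-x)) := by
  have hc : Continuous fun x : ℝ => Real.exp (-Real.exp (-x)) := by fun_prop
  have : Function.leftLim gumbelCDF x = gumbelCDF x :=
    leftLim_eq_of_tendsto ((hc.tendsto x).mono_left nhdsWithin_le_nhds)
  rw [measureReal_def, gumbel, gumbelCDF.measure_Iio tendsto_gumbelCDF_atBot, this, sub_zero]
  exact ENNReal.toReal_ofReal (Real.exp_pos _).le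

theorem measurable_floor_gumbel (l s : ℝ) : Measurable fun x : ℝ => ⌊x / l + s⌋ := by
  fun_prop

/-- The floor is at most `j` iff `x < (j + 1) log (1/q) - log B`, and there `exp (-x)` becomes `B
q^(j+1)`: rounded Gumbel variables fit `HasGumbelCDF` exactly. -/
theorem gumbel_map_floor_real_Iic {q B : ℝ} (hq0 : 0 < q) (hq1 : q < 1) (hB : 0 < B) (j : ℤ) :
    (gumbel.map fun x => ⌊x / Real.log (1 / q) + Real.log B / Real.log (1 / q)⌋).real
      (Set.Iic j) = Real.exp (-(B * q ^ (j + 1))) := by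
  have hl : 0 < Real.log (1 / q) := Real.log_pos (by rw [lt_div_iff₀ hq0]; linarith)
  rw [map_measureReal_apply (measurable_floor_gumbel _ _) measurableSet_Iic]
  have : (fun x : ℝ => ⌊x / Real.log (1 / q) + Real.log B / Real.log (1 / q)⌋) ⁻¹' Set.Iic j =
      Set.Iio ((j + 1 : ℤ) * Real.log (1 / q) - Real.log B) := by
    ext x
    rw [Set.mem_preimage, Set.mem_Iic, Set.mem_Iio, ← Int.lt_add_one_iff, Int.floor_lt, ← add_div,
      div_lt_iff₀ hl, lt_sub_iff_add_lt]
  rw [this, gumbel_real_Iio, neg_sub, Real.exp_sub, Real.exp_log hB, one_div, Real.log_inv,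
    mul_neg, Real.exp_neg (_ * _), div_inv_eq_mul, ← Real.log_zpow, Real.exp_log (zpow_pos hq0 _)]

instance (l s : ℝ) : IsProbabilityMeasure (gumbel.map fun x => ⌊x / l + s⌋) :=
  Measure.isProbabilityMeasure_map (measurable_floor_gumbel _ _).aemeasurable

theorem geometricMeasure_real_Iic {p : unitInterval} (hp : p ≠ 0) (K : ℕ) :
    (geometricMeasure p).real (Set.Iic K) = 1 - (1 - p : ℝ) ^ (K + 1) := by
  have h : (Set.Iic K : Set ℕ) = (Finset.range (K + 1) : Finset ℕ) := by
    ext x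
    simp
  rw [h, ← sum_measureReal_singleton]
  simp_rw [geometricMeasure_real_singleton hp]
  rw [← Finset.sum_mul]
  have := geom_sum_mul_neg (1 - p : ℝ) (K + 1)
  rw [sub_sub_cancel] at this
  exact this

instance (p : unitInterval) (N : ℕ) : IsProbabilityMeasure (maxGeometric p N) :=
  Measure.isProbabilityMeasure_map (Measurable.of_discrete (α := Fin N → ℕ)).aemeasurable

theorem maxGeometric_real_Iic {p : unitInterval} (hp : p ≠ 0) (N K : ℕ) :
    (maxGeometric p N).real (Set.Iic (K : ℤ)) = (1 - (1 - p : ℝ) ^ (K + 1)) ^ N := by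
  rw [maxGeometric, map_measureReal_apply .of_discrete measurableSet_Iic]
  have : (fun x : Fin N → ℕ => ((Finset.univ.sup x : ℕ) : ℤ)) ⁻¹' Set.Iic (K : ℤ) =
      Set.pi Set.univ fun _ => Set.Iic K := by
    ext x
    simp [Pi.le_def]
  rw [this, measureReal_def, Measure.pi_pi, ENNReal.toReal_prod]
  simp_rw [← measureReal_def, geometricMeasure_real_Iic hp]
  simp

/-! ### Sequences with convergent ratios -/

/-- Nonnegative sequences whose ratios of consecutive terms converge to `q ∈ (0, 1)`. -/
structure GeomRatio (p : ℕ → ℝ) (q : ℝ) : Prop where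
  nonneg : ∀ k, 0 ≤ p k
  q_pos : 0 < q
  q_lt_one : q < 1
  ratio : Tendsto (fun k => p (k + 1) / p k) atTop (𝓝 q)

namespace GeomRatio

variable {p : ℕ → ℝ} {q : ℝ}

/-- Eventually all ratios lie between `s = q / 2` and `r = (1 + q) / 2`; iteration gives a two-sided
geometric comparison. -/
theorem exists_bounds (h : GeomRatio p q) : ∃ s r : ℝ, 0 < s ∧ s < 1 ∧ 0 < r ∧ r < 1 ∧
    ∃ k₀, ∀ k ≥ k₀, 0 < p k ∧ ∀ i, s ^ i * p k ≤ p (k + i) ∧ p (k + i) ≤ r ^ i * p k := by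
  have hq0 := h.q_pos
  have hq1 := h.q_lt_one
  refine ⟨q / 2, (1 + q) / 2, by linarith, by linarith, by linarith, by linarith, ?_⟩
  obtain ⟨k₀, hk₀⟩ := eventually_atTop.1 ((h.ratio.eventually (lt_mem_nhds (half_lt_self hq0))).and
    (h.ratio.eventually (gt_mem_nhds (show q < (1 + q) / 2 by linarith))))
  have hpos : ∀ k ≥ k₀, 0 < p k := by
    intro k hk
    refine lt_of_le_of_ne (h.nonneg k) fun h0 => ?_
    -- A zero term would make the ratio `x / 0 = 0`, below `q / 2`.
    have := (hk₀ k hk).1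
    rw [← h0, div_zero] at this
    linarith
  refine ⟨k₀, fun k hk => ⟨hpos k hk, fun i => ?_⟩⟩
  induction i with
  | zero => simp
  | succ i ih =>
    have hp := hpos (k + i) (by omega)
    obtain ⟨h1, h2⟩ := hk₀ (k + i) (by omega)
    rw [lt_div_iff₀ hp] at h1
    rw [div_lt_iff₀ hp] at h2
    rw [← add_assoc, pow_succ', pow_succ', mul_assoc, mul_assoc]
    constructor
    · refine le_trans ?_ h1.le
      gcongr
      exact ih.1
    · refine h2.le.trans ?_
      gcongr
      exact ih.2

theorem eventually_pos (h : GeomRatio p q) : ∀ᶠ k in atTop, 0 < p k := by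
  obtain ⟨s, r, -, -, -, -, k₀, hk₀⟩ := h.exists_bounds
  exact eventually_atTop.2 ⟨k₀, fun k hk => (hk₀ k hk).1⟩

theorem tendsto_add_div (h : GeomRatio p q) (i : ℕ) :
    Tendsto (fun k => p (k + i) / p k) atTop (𝓝 (q ^ i)) := by
  induction i with
  | zero =>
    refine tendsto_const_nhds.congr' ?_
    filter_upwards [h.eventually_pos] with k hk
    rw [add_zero, div_self hk.ne', pow_zero]
  | succ i ih =>
    rw [pow_succ']
    refine ((h.ratio.comp (tendsto_add_atTop_nat i)).mul ih).congr' ?_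
    filter_upwards [(tendsto_add_atTop_nat i).eventually h.eventually_pos] with k hk
    simp only [Function.comp_apply]
    rw [div_mul_div_cancel₀ hk.ne']
    rfl

theorem tendsto_shift_div (h : GeomRatio p q) {k : ℕ → ℕ} (hk : Tendsto k atTop atTop) (j : ℤ) :
    Tendsto (fun n => p ((k n + j).toNat) / p (k n)) atTop (𝓝 (q ^ j)) := by
  obtain ⟨i, rfl | rfl⟩ := j.eq_nat_or_neg
  · rw [zpow_natCast]
    exact (h.tendsto_add_div i).comp hk
  · rw [zpow_neg, zpow_natCast]
    have h1 : Tendsto (fun n => k n - i) atTop atTop := (tendsto_sub_atTop_nat i).comp hk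
    refine (((h.tendsto_add_div i).inv₀ (pow_ne_zero _ h.q_pos.ne')).comp h1).congr' ?_
    filter_upwards [hk.eventually_ge_atTop i] with n hn
    have h2 : ((k n : ℤ) + -(i : ℤ)).toNat = k n - i := by omega
    simp only [Function.comp_apply]
    rw [inv_div, h2, Nat.sub_add_cancel hn]

theorem summable (h : GeomRatio p q) : Summable p := by
  refine summable_of_ratio_test_tendsto_lt_one h.q_lt_one
    (h.eventually_pos.mono fun k hk => hk.ne') ?_
  refine h.ratio.congr fun k => ?_
  rw [Real.norm_eq_abs, Real.norm_eq_abs, abs_of_nonneg (h.nonneg _), abs_of_nonneg (h.nonneg _)]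

theorem tendsto_zero (h : GeomRatio p q) : Tendsto p atTop (𝓝 0) := h.summable.tendsto_atTop_zero

/-- Termwise the quotient tends to the geometric series `∑ q^(i+1)`, with `r ^ i` as majorant. -/
theorem tendsto_tailSum_div (h : GeomRatio p q) :
    Tendsto (fun K => tailSum p K / p K) atTop (𝓝 (q / (1 - q))) := by
  obtain ⟨s, r, -, -, hr0, hr1, k₀, hk₀⟩ := h.exists_bounds
  have hlim : q / (1 - q) = ∑' i : ℕ, q ^ (i + 1) := by
    simp_rw [pow_succ']
    rw [tsum_mul_left, tsum_geometric_of_lt_one h.q_pos.le h.q_lt_one, div_eq_mul_inv]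
  rw [hlim]
  simp_rw [tailSum, ← tsum_div_const]
  refine tendsto_tsum_of_dominated_convergence (bound := fun i => r ^ i)
    (summable_geometric_of_lt_one hr0.le hr1) ?_ ?_
  · intro i
    refine (h.tendsto_add_div (i + 1)).congr fun K => ?_
    congr 2
    ring
  · filter_upwards [eventually_ge_atTop k₀] with K hK i
    obtain ⟨hp, hb⟩ := hk₀ K hK
    rw [Real.norm_eq_abs, abs_of_nonneg (div_nonneg (h.nonneg _) hp.le), div_le_iff₀ hp,
      show i + (K + 1) = K + (i + 1) by ring]
    refine (hb (i + 1)).2.trans ?_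
    gcongr ?_ * _
    exact pow_le_pow_of_le_one hr0.le hr1.le (Nat.le_succ i)

/-- Geometric decay turns comparison up to a constant factor into comparison of indices up to a
bounded shift. -/
theorem isBigO_comp_iff (h : GeomRatio p q) {k l : ℕ → ℕ} (hk : Tendsto k atTop atTop)
    (hl : Tendsto l atTop atTop) :
    (fun n => p (k n)) =O[atTop] (fun n => p (l n)) ↔ ∃ D, ∀ᶠ n in atTop, l n ≤ k n + D := by
  obtain ⟨s, r, hs0, hs1, hr0, hr1, k₀, hk₀⟩ := h.exists_bounds
  constructor
  · intro hO
    obtain ⟨C, hC0, hC⟩ := hO.exists_pos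
    -- With `C * r ^ D < 1`, an index `l n > k n + D` would give `p (k n) < p (k n)`.
    obtain ⟨D, hD⟩ := exists_pow_lt_of_lt_one (inv_pos.2 hC0) hr1
    refine ⟨D, ?_⟩
    filter_upwards [hC.bound, hk.eventually_ge_atTop k₀, hl.eventually_ge_atTop k₀]
      with n hn hkn hln
    by_contra! hcon
    obtain ⟨i, hi⟩ := Nat.exists_eq_add_of_le hcon.le
    have hp := (hk₀ (k n) hkn).1
    have hb := ((hk₀ (k n) hkn).2 (D + i)).2
    rw [← add_assoc, ← hi] at hb
    rw [Real.norm_eq_abs, Real.norm_eq_abs, abs_of_nonneg (h.nonneg _),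
      abs_of_nonneg (h.nonneg _)] at hn
    have h1 : r ^ (D + i) ≤ r ^ D := pow_le_pow_of_le_one hr0.le hr1.le (Nat.le_add_right _ _)
    have h2 : C * r ^ D < 1 := by
      have := mul_lt_mul_of_pos_left hD hC0
      rwa [mul_inv_cancel₀ hC0.ne'] at this
    have h3 : p (k n) ≤ C * r ^ D * p (k n) := by
      calc p (k n) ≤ C * p (l n) := hn
        _ ≤ C * (r ^ D * p (k n)) := by
          gcongr
          exact hb.trans (by gcongr)
        _ = C * r ^ D * p (k n) := by ring
    nlinarith
  · rintro ⟨D, hD⟩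
    refine IsBigO.of_bound (s ^ D)⁻¹ ?_
    filter_upwards [hD, hk.eventually_ge_atTop k₀, hl.eventually_ge_atTop k₀] with n hn hkn hln
    rw [Real.norm_eq_abs, Real.norm_eq_abs, abs_of_nonneg (h.nonneg _),
      abs_of_nonneg (h.nonneg _), le_inv_mul_iff₀ (pow_pos hs0 D)]
    rcases le_total (k n) (l n) with hle | hle
    · obtain ⟨i, hi⟩ := Nat.exists_eq_add_of_le hle
      have hb := ((hk₀ (k n) hkn).2 i).1
      rw [← hi] at hb
      refine le_trans ?_ hb
      gcongr ?_ * _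
      · exact h.nonneg _
      · exact pow_le_pow_of_le_one hs0.le hs1.le (by omega)
    · obtain ⟨i, hi⟩ := Nat.exists_eq_add_of_le hle
      have hb := ((hk₀ (l n) hln).2 i).2
      rw [← hi] at hb
      have h1 : r ^ i ≤ 1 := pow_le_one₀ hr0.le hr1.le
      have h2 : s ^ D ≤ 1 := pow_le_one₀ hs0.le hs1.le
      have h3 := h.nonneg (l n)
      have h4 := h.nonneg (k n)
      nlinarith

theorem isTheta_comp_iff (h : GeomRatio p q) {k l : ℕ → ℕ} (hk : Tendsto k atTop atTop)
    (hl : Tendsto l atTop atTop) :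
    (fun n => p (k n)) =Θ[atTop] (fun n => p (l n)) ↔
      (fun n => (k n : ℝ) - (l n : ℝ)) =O[atTop] (fun _ => (1 : ℝ)) := by
  rw [IsTheta, h.isBigO_comp_iff hk hl, h.isBigO_comp_iff hl hk]
  constructor
  · rintro ⟨⟨D, hD⟩, ⟨D', hD'⟩⟩
    refine IsBigO.of_bound (D + D' : ℝ) ?_
    filter_upwards [hD, hD'] with n h1 h2
    have h1' : (l n : ℝ) ≤ k n + D := by exact_mod_cast h1
    have h2' : (k n : ℝ) ≤ l n + D' := by exact_mod_cast h2
    have h3 : (0 : ℝ) ≤ D := Nat.cast_nonneg D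
    have h4 : (0 : ℝ) ≤ D' := Nat.cast_nonneg D'
    rw [norm_one, mul_one, Real.norm_eq_abs, abs_le]
    constructor <;> linarith
  · intro hO
    obtain ⟨C, hC⟩ := hO.bound
    have hC' : ∀ᶠ n in atTop, |(k n : ℝ) - l n| ≤ (⌈C⌉₊ : ℝ) := by
      filter_upwards [hC] with n hn
      rw [norm_one, mul_one, Real.norm_eq_abs] at hn
      exact hn.trans (Nat.le_ceil C)
    refine ⟨⟨⌈C⌉₊, ?_⟩, ⟨⌈C⌉₊, ?_⟩⟩ <;> filter_upwards [hC'] with n hn <;> rw [abs_le] at hn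
    · have : (l n : ℝ) ≤ ((k n + ⌈C⌉₊ : ℕ) : ℝ) := by push_cast; linarith
      exact_mod_cast this
    · have : (k n : ℝ) ≤ ((l n + ⌈C⌉₊ : ℕ) : ℝ) := by push_cast; linarith
      exact_mod_cast this

theorem eventually_mul_bounds {k : ℕ → ℕ}
    (hk : (fun n => p (k n)) =Θ[atTop] (fun n : ℕ => 1 / (n : ℝ))) (hp : ∀ k, 0 ≤ p k) :
    ∃ c C : ℝ, 0 < c ∧ ∀ᶠ n : ℕ in atTop, c ≤ n * p (k n) ∧ n * p (k n) ≤ C := by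
  obtain ⟨C, hC0, hC⟩ := hk.1.exists_pos
  obtain ⟨C', hC0', hC'⟩ := hk.2.exists_pos
  refine ⟨C'⁻¹, C, inv_pos.2 hC0', ?_⟩
  filter_upwards [hC.bound, hC'.bound, eventually_gt_atTop 0] with n h1 h2 hn0
  have hn' : (0 : ℝ) < n := by exact_mod_cast hn0
  simp only [Real.norm_eq_abs, abs_of_nonneg (hp _), abs_of_pos (one_div_pos.2 hn')] at h1 h2
  constructor
  · rw [inv_le_iff_one_le_mul₀ hC0']
    rw [div_le_iff₀ hn'] at h2
    linarith
  · rw [mul_one_div, le_div_iff₀ hn'] at h1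
    linarith

/-- Each value `i` is eventually avoided: if `p i = 0` by the lower bound on `n * p (k n)`,
otherwise because `p (k n) → 0`. -/
theorem tendsto_atTop_of_isTheta (h : GeomRatio p q) {k : ℕ → ℕ}
    (hk : (fun n => p (k n)) =Θ[atTop] (fun n : ℕ => 1 / (n : ℝ))) : Tendsto k atTop atTop := by
  obtain ⟨c, C, hc, hb⟩ := eventually_mul_bounds hk h.nonneg
  have h0 : Tendsto (fun n => p (k n)) atTop (𝓝 0) :=
    hk.1.trans_tendsto tendsto_one_div_atTop_nhds_zero_nat
  have hne : ∀ i, ∀ᶠ n in atTop, k n ≠ i := by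
    intro i
    rcases (h.nonneg i).eq_or_lt with hi | hi
    · filter_upwards [hb] with n hn hki
      rw [hki, ← hi, mul_zero] at hn
      linarith [hn.1]
    · filter_upwards [h0.eventually (gt_mem_nhds hi)] with n hn hki
      rw [hki] at hn
      exact lt_irrefl _ hn
  rw [tendsto_atTop]
  intro b
  have := (Finset.range b).eventually_all.2 fun i _ => hne i
  filter_upwards [this] with n hn
  by_contra! hlt
  exact hn (k n) (Finset.mem_range.2 hlt) rfl

/-- For `n = 0` the set would be all of `ℕ`, since `1 / 0 = 0`. -/
theorem finite_setOf_le (h : GeomRatio p q) {n : ℕ} (hn : 0 < n) :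
    {k : ℕ | 1 / (n : ℝ) ≤ p k}.Finite := by
  have hn' : (0 : ℝ) < 1 / n := by
    have : (0 : ℝ) < n := by exact_mod_cast hn
    positivity
  obtain ⟨k₀, hk₀⟩ := eventually_atTop.1 (h.tendsto_zero.eventually (gt_mem_nhds hn'))
  refine (Set.finite_Iio k₀).subset fun k hk => ?_
  by_contra hcon
  exact absurd (hk₀ k (not_lt.1 hcon)) (not_lt.2 hk)

theorem tendsto_sSup (h : GeomRatio p q) :
    Tendsto (fun n : ℕ => sSup {k : ℕ | 1 / (n : ℝ) ≤ p k}) atTop atTop := by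
  rw [tendsto_atTop]
  intro b
  obtain ⟨i, hi, hib⟩ := (h.eventually_pos.and (eventually_ge_atTop b)).exists
  filter_upwards [tendsto_one_div_atTop_nhds_zero_nat.eventually (gt_mem_nhds hi),
    eventually_gt_atTop 0] with n hn hn0
  exact hib.trans (le_csSup (h.finite_setOf_le hn0).bddAbove (show _ ≤ _ from hn.le))

/-- Maximality gives `p (K + 1) < 1 / n`, and one step back costs at most a factor `s⁻¹`; membership
of `K` gives the other bound. -/
theorem isTheta_sSup (h : GeomRatio p q) :
    (fun n : ℕ => p (sSup {k : ℕ | 1 / (n : ℝ) ≤ p k})) =Θ[atTop] (fun n : ℕ => 1 / (n : ℝ)) := by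
  obtain ⟨s, r, hs0, -, -, -, k₀, hk₀⟩ := h.exists_bounds
  obtain ⟨i, hi⟩ := h.eventually_pos.exists
  constructor
  · refine IsBigO.of_bound s⁻¹ ?_
    filter_upwards [h.tendsto_sSup.eventually_ge_atTop k₀, eventually_gt_atTop 0] with n hn hn0
    have hn' : (0 : ℝ) < n := by exact_mod_cast hn0
    set K := sSup {k : ℕ | 1 / (n : ℝ) ≤ p k} with hK
    have h1 : p (K + 1) < 1 / n := by
      by_contra! hcon
      have := le_csSup (h.finite_setOf_le hn0).bddAbove hcon
      omega
    have h2 := ((hk₀ K hn).2 1).1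
    rw [pow_one] at h2
    rw [Real.norm_eq_abs, abs_of_nonneg (h.nonneg _), Real.norm_eq_abs,
      abs_of_pos (by positivity), le_inv_mul_iff₀ hs0]
    linarith
  · refine IsBigO.of_bound 1 ?_
    filter_upwards [tendsto_one_div_atTop_nhds_zero_nat.eventually (gt_mem_nhds hi),
      eventually_gt_atTop 0] with n hn hn0
    have := Nat.sSup_mem (s := {k : ℕ | 1 / (n : ℝ) ≤ p k}) ⟨i, hn.le⟩
      (h.finite_setOf_le hn0).bddAbove
    rw [one_mul, Real.norm_eq_abs, Real.norm_eq_abs, abs_of_nonneg (h.nonneg _),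
      abs_of_nonneg (by positivity)]
    exact this

theorem isTheta_iff_sSup (h : GeomRatio p q) (k : ℕ → ℕ) :
    (fun n => p (k n)) =Θ[atTop] (fun n : ℕ => 1 / (n : ℝ)) ↔
      (fun n : ℕ => (k n : ℝ) - ((sSup {k : ℕ | 1 / (n : ℝ) ≤ p k} : ℕ) : ℝ)) =O[atTop]
        (fun _ => (1 : ℝ)) := by
  constructor
  · intro hk
    exact (h.isTheta_comp_iff (h.tendsto_atTop_of_isTheta hk) h.tendsto_sSup).1
      (hk.trans h.isTheta_sSup.symm)
  · intro hO
    have hk : Tendsto k atTop atTop := by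
      obtain ⟨C, hC⟩ := hO.bound
      rw [tendsto_atTop]
      intro b
      filter_upwards [hC, h.tendsto_sSup.eventually_ge_atTop (b + ⌈C⌉₊)] with n hn hb
      rw [norm_one, mul_one, Real.norm_eq_abs, abs_le] at hn
      have h1 : ((b + ⌈C⌉₊ : ℕ) : ℝ) ≤ ((sSup {k : ℕ | 1 / (n : ℝ) ≤ p k} : ℕ) : ℝ) := by
        exact_mod_cast hb
      push_cast at h1
      have h2 := Nat.le_ceil C
      have : (b : ℝ) ≤ k n := by linarith [hn.1]
      exact_mod_cast this
    exact ((h.isTheta_comp_iff hk h.tendsto_sSup).2 hO).trans h.isTheta_sSup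

/-- Convergence would force `p (k (n + 1)) / p (k n) → 1`. Different large indices give ratios at
most `r` or at least `r⁻¹`, so `k` would be eventually constant. -/
theorem not_tendsto_mul (h : GeomRatio p q) {k : ℕ → ℕ} (hk : Tendsto k atTop atTop) {b : ℝ}
    (hb : 0 < b) : ¬ Tendsto (fun n : ℕ => n * p (k n)) atTop (𝓝 b) := by
  intro hlim
  obtain ⟨s, r, -, -, hr0, hr1, k₀, hk₀⟩ := h.exists_bounds
  have hratio : Tendsto (fun n => p (k (n + 1)) / p (k n)) atTop (𝓝 1) := by
    have h1 := (hlim.comp (tendsto_add_atTop_nat 1)).div hlim hb.ne'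
    have h2 := h1.mul (tendsto_natCast_div_add_atTop (1 : ℝ))
    rw [div_self hb.ne', mul_one] at h2
    refine h2.congr' ?_
    filter_upwards [eventually_gt_atTop 0] with n hn0
    have hn' : (0 : ℝ) < n := by exact_mod_cast hn0
    simp only [Function.comp_apply, Pi.div_apply]
    push_cast
    field_simp
  have hconst : ∀ᶠ n in atTop, k (n + 1) = k n := by
    filter_upwards [hratio.eventually (lt_mem_nhds hr1),
      hratio.eventually (gt_mem_nhds (one_lt_inv₀ hr0 |>.2 hr1)), hk.eventually_ge_atTop k₀,
      (hk.comp (tendsto_add_atTop_nat 1)).eventually_ge_atTop k₀] with n h1 h2 h3 h4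
    simp only [Function.comp_apply] at h4
    have hp1 := (hk₀ _ h3).1
    have hp2 := (hk₀ _ h4).1
    rw [lt_div_iff₀ hp1] at h1
    rw [div_lt_iff₀ hp1, lt_inv_mul_iff₀ hr0] at h2
    rcases lt_trichotomy (k (n + 1)) (k n) with hlt | heq | hgt
    · obtain ⟨i, hi⟩ := Nat.exists_eq_add_of_lt hlt
      have hbd := ((hk₀ _ h4).2 (i + 1)).2
      rw [← add_assoc, ← hi] at hbd
      have h5 : r ^ (i + 1) ≤ r := pow_le_of_le_one hr0.le hr1.le (by omega)
      nlinarith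
    · exact heq
    · obtain ⟨i, hi⟩ := Nat.exists_eq_add_of_lt hgt
      have hbd := ((hk₀ _ h3).2 (i + 1)).2
      rw [← add_assoc, ← hi] at hbd
      have h5 : r ^ (i + 1) ≤ r := pow_le_of_le_one hr0.le hr1.le (by omega)
      nlinarith
  obtain ⟨N, hN⟩ := eventually_atTop.1 hconst
  have hall : ∀ n ≥ N, k n = k N := by
    intro n hn
    induction n, hn using Nat.le_induction with
    | base => rfl
    | succ n hn ih => rw [hN n hn, ih]
  obtain ⟨n, hn1, hn2⟩ := ((hk.eventually_gt_atTop (k N)).and (eventually_ge_atTop N)).exists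
  rw [hall n hn2] at hn1
  exact lt_irrefl _ hn1

end GeomRatio

/-! ### Asymptotics of the four distribution functions -/

theorem exp_neg_sub_exp_neg_le {x y : ℝ} (hx : 0 ≤ x) : Real.exp (-x) - Real.exp (-y) ≤ |x - y| := by
  have h1 := Real.add_one_le_exp (x - y)
  have h2 : Real.exp (-y) = Real.exp (-x) * Real.exp (x - y) := by
    rw [← Real.exp_add]
    congr 1
    ring
  have h3 : Real.exp (-x) ≤ 1 := Real.exp_le_one_iff.2 (by linarith)
  have h4 := Real.exp_pos (-x)
  have h5 := neg_abs_le (x - y)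
  have h6 := abs_nonneg (x - y)
  rw [h2]
  nlinarith

theorem abs_exp_neg_sub_exp_neg_le {x y : ℝ} (hx : 0 ≤ x) (hy : 0 ≤ y) :
    |Real.exp (-x) - Real.exp (-y)| ≤ |x - y| := by
  rw [abs_le]
  constructor
  · have := exp_neg_sub_exp_neg_le (x := y) (y := x) hy
    rw [abs_sub_comm] at this
    linarith
  · exact exp_neg_sub_exp_neg_le hx

theorem tendsto_exp_neg_sub {x y : ℕ → ℝ} (hx : ∀ᶠ n in atTop, 0 ≤ x n)
    (hy : ∀ᶠ n in atTop, 0 ≤ y n) (h : Tendsto (fun n => x n - y n) atTop (𝓝 0)) :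
    Tendsto (fun n => Real.exp (-x n) - Real.exp (-y n)) atTop (𝓝 0) := by
  rw [tendsto_zero_iff_abs_tendsto_zero] at h ⊢
  refine squeeze_zero' (Eventually.of_forall fun _ => abs_nonneg _) ?_ h
  filter_upwards [hx, hy] with n h1 h2
  exact abs_exp_neg_sub_exp_neg_le h1 h2

/-- From `-x / (1 - x) ≤ log (1 - x) ≤ -x`: the two exponents, multiplied by `N`, differ by the
error bound. -/
theorem abs_one_sub_pow_sub_exp_le {x : ℝ} (hx0 : 0 ≤ x) (hx1 : x < 1) (N : ℕ) :
    |(1 - x) ^ N - Real.exp (-(N * x))| ≤ N * x * (x / (1 - x)) := by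
  have h1 : 0 < 1 - x := by linarith
  have hN : (0 : ℝ) ≤ N := Nat.cast_nonneg N
  have hup : (1 - x) ^ N ≤ Real.exp (-(N * x)) := by
    rw [← mul_neg, Real.exp_nat_mul]
    gcongr
    have := Real.add_one_le_exp (-x)
    linarith
  have hlow : Real.exp (-(N * (x / (1 - x)))) ≤ (1 - x) ^ N := by
    rw [← mul_neg, Real.exp_nat_mul]
    gcongr
    rw [← Real.le_log_iff_exp_le h1]
    have := Real.one_sub_inv_le_log_of_pos h1
    refine le_trans (le_of_eq ?_) this
    field_simp
    ring
  have hd := exp_neg_sub_exp_neg_le (x := N * x) (y := N * (x / (1 - x))) (by positivity)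
  have he : |N * x - N * (x / (1 - x))| = N * x * (x / (1 - x)) := by
    rw [abs_sub_comm, show N * (x / (1 - x)) - N * x = N * x * (x / (1 - x)) by field_simp; ring,
      abs_of_nonneg (by positivity)]
  rw [he] at hd
  rw [abs_le]
  constructor <;> linarith [show 0 ≤ N * x * (x / (1 - x)) by positivity]

section

variable {p : ℕ → ℝ} {q lam : ℝ} {k : ℕ → ℕ}

theorem tendsto_toNat_add (hk : Tendsto k atTop atTop) (j : ℤ) :
    Tendsto (fun n => (k n + j).toNat) atTop atTop := by
  rw [tendsto_atTop]
  intro b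
  filter_upwards [hk.eventually_ge_atTop (b + j.natAbs)] with n hn
  omega

/-- Write the tail as `p (k n)` times a shift ratio, tending to `q ^ j`, times a tail ratio, tending
to `q / (1 - q)`; the prefactor `n * p (k n)` is bounded. -/
theorem GeomRatio.tendsto_mul_tailSum_sub (h : GeomRatio p q)
    (hk : (fun n => p (k n)) =Θ[atTop] (fun n : ℕ => 1 / (n : ℝ))) (j : ℤ) :
    Tendsto (fun n : ℕ => n * tailSum p ((k n + j).toNat) -
      n * p (k n) / (1 - q) * q ^ (j + 1)) atTop (𝓝 0) := by
  have hk' := h.tendsto_atTop_of_isTheta hk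
  obtain ⟨c, C, hc, hb⟩ := eventually_mul_bounds hk h.nonneg
  have hK := tendsto_toNat_add hk' j
  have h1 := ((h.tendsto_shift_div hk' j).mul (h.tendsto_tailSum_div.comp hK)).sub_const
    (q ^ j * (q / (1 - q)))
  rw [sub_self] at h1
  have h2 : Tendsto (fun n : ℕ => (n * p (k n)) * ((p ((k n + j).toNat) / p (k n)) *
      (tailSum p ((k n + j).toNat) / p ((k n + j).toNat)) - q ^ j * (q / (1 - q)))) atTop
      (𝓝 0) := by
    refine isBoundedUnder_le_mul_tendsto_zero ?_ h1
    refine isBoundedUnder_of_eventually_le (a := C) ?_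
    filter_upwards [hb] with n hn
    simp only [Function.comp_apply]
    rw [Real.norm_eq_abs, abs_of_nonneg (by linarith [hn.1])]
    exact hn.2
  refine h2.congr' ?_
  filter_upwards [hk'.eventually h.eventually_pos, hK.eventually h.eventually_pos] with n h3 h4
  rw [zpow_add_one₀ h.q_pos.ne']
  have h5 : 1 - q ≠ 0 := by linarith [h.q_lt_one]
  field_simp

theorem GeomRatio.eventually_gumbel_bounds (h : GeomRatio p q)
    (hk : (fun n => p (k n)) =Θ[atTop] (fun n : ℕ => 1 / (n : ℝ))) :
    ∃ c C : ℝ, 0 < c ∧ ∀ᶠ n : ℕ in atTop, c ≤ n * p (k n) / (1 - q) ∧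
      n * p (k n) / (1 - q) ≤ C := by
  obtain ⟨c, C, hc, hb⟩ := eventually_mul_bounds hk h.nonneg
  have h1 : 0 < 1 - q := by linarith [h.q_lt_one]
  refine ⟨c / (1 - q), C / (1 - q), by positivity, ?_⟩
  filter_upwards [hb] with n hn
  exact ⟨by gcongr; exact hn.1, by gcongr; exact hn.2⟩

theorem hasGumbelCDF_of_tendsto {B : ℕ → ℝ} {κ : ℕ → ℤ} {μ : ℕ → Measure ℤ} (hq : 0 ≤ q)
    (hB : ∀ᶠ n in atTop, 0 ≤ B n)
    (h : ∀ j : ℤ, ∃ x : ℕ → ℝ, (∀ᶠ n in atTop, 0 ≤ x n) ∧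
      Tendsto (fun n => (μ n).real (Set.Iic (κ n + j)) - Real.exp (-x n)) atTop (𝓝 0) ∧
      Tendsto (fun n => x n - B n * q ^ (j + 1)) atTop (𝓝 0)) :
    HasGumbelCDF q B κ μ := by
  intro j
  obtain ⟨x, hx0, hx1, hx2⟩ := h j
  have := hx1.add (tendsto_exp_neg_sub hx0 (hB.mono fun n hn => mul_nonneg hn
    (zpow_nonneg hq _)) hx2)
  simpa using this

theorem hasGumbelCDF_maxOccupancy {w : ℕ → ℝ≥0} {t s : ℝ} (ht : 0 < t) (hs : 0 < s)
    (h : LatticeLaw (fun k => w k * t ^ k / s) lam) (hg : GeomRatio (fun k => w k * t ^ k / s) q)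
    {m : ℕ → ℕ} (hm : (fun n : ℕ => (m n : ℝ) - lam * n) =o[atTop] (fun n : ℕ => √(n : ℝ)))
    (hk : (fun n => w (k n) * t ^ k n / s) =Θ[atTop] (fun n : ℕ => 1 / (n : ℝ))) :
    HasGumbelCDF q (fun n => n * (w (k n) * t ^ k n / s) / (1 - q)) (fun n => k n)
      (fun n => (maxOccupancy w (m n) n).toMeasure) := by
  set p : ℕ → ℝ := fun k => w k * t ^ k / s with hp
  have hk' := hg.tendsto_atTop_of_isTheta hk
  obtain ⟨c, C, hc, hb⟩ := hg.eventually_gumbel_bounds hk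
  refine hasGumbelCDF_of_tendsto hg.q_pos.le (hb.mono fun n hn => hc.le.trans hn.1) fun j => ?_
  have hK := tendsto_toNat_add hk' j
  have hd := hg.tendsto_mul_tailSum_sub hk j
  refine ⟨_, Eventually.of_forall fun n =>
    mul_nonneg (Nat.cast_nonneg n) (h.tailSum_nonneg _), ?_, hd⟩
  -- `tendsto_truncCoeff_div` needs a bound for every `n`; an eventual bound on a sequence gives
  -- one.
  have hbdd : IsBoundedUnder (· ≤ ·) atTop
      (fun n : ℕ => (n : ℝ) * tailSum p ((k n + j).toNat)) := by
    refine isBoundedUnder_of_eventually_le (a := 1 + C * q ^ (j + 1)) ?_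
    filter_upwards [hd.eventually (gt_mem_nhds one_pos), hb] with n h1 h2
    have h3 : n * p (k n) / (1 - q) * q ^ (j + 1) ≤ C * q ^ (j + 1) := by
      have := zpow_pos hg.q_pos (j + 1)
      gcongr
      exact h2.2
    linarith
  obtain ⟨C', hC'⟩ := hbdd.bddAbove_range
  refine (h.tendsto_truncCoeff_div hK (fun n => hC' (Set.mem_range_self n)) hm).congr' ?_
  filter_upwards [h.eventually_truncCoeff_pos hm, hk'.eventually_ge_atTop j.natAbs] with n hn hkn
  rw [hp, truncCoeff_tilt, truncCoeff_tilt] at *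
  have htm : t ^ m n / s ^ n ≠ 0 := by positivity
  have hZ : partitionFun w (m n) n ≠ 0 := by
    intro h0
    rw [← coe_partitionFun, h0] at hn
    simp at hn
  rw [mul_div_mul_left _ _ htm, ← coe_partitionFun, ← maxOccupancy_real_Iic w hZ,
    Int.toNat_of_nonneg (by omega)]

theorem eventually_partitionFun_pos {w : ℕ → ℝ≥0} {t s : ℝ} (ht : 0 < t) (hs : 0 < s)
    (h : LatticeLaw (fun k => w k * t ^ k / s) lam) {m : ℕ → ℕ}
    (hm : (fun n : ℕ => (m n : ℝ) - lam * n) =o[atTop] (fun n : ℕ => √(n : ℝ))) :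
    ∀ᶠ n in atTop, 0 < partitionFun w (m n) n := by
  filter_upwards [h.eventually_truncCoeff_pos hm] with n hn
  rw [truncCoeff_tilt, ← coe_partitionFun, mul_pos_iff_of_pos_left (by positivity)] at hn
  exact_mod_cast hn

/-- The difference is the bounded quantity `B_n q^(j+1)` times the relative error of `N n`. -/
theorem GeomRatio.tendsto_equivalent_sub (h : GeomRatio p q)
    (hk : (fun n => p (k n)) =Θ[atTop] (fun n : ℕ => 1 / (n : ℝ))) {N : ℕ → ℕ}
    (hN : (fun n => (N n : ℝ)) ~[atTop] (fun n : ℕ => n * p (k n) * (q ^ k n)⁻¹ / (1 - q)))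
    (j : ℤ) : Tendsto (fun n : ℕ => N n * q ^ (k n + j + 1 : ℤ) -
      n * p (k n) / (1 - q) * q ^ (j + 1)) atTop (𝓝 0) := by
  obtain ⟨c, C, hc, hb⟩ := h.eventually_gumbel_bounds hk
  have hq1 : 0 < 1 - q := by linarith [h.q_lt_one]
  have hpos : ∀ᶠ n : ℕ in atTop, n * p (k n) * (q ^ k n)⁻¹ / (1 - q) ≠ 0 := by
    filter_upwards [hb] with n hn
    have h1 := hc.trans_le hn.1
    have h2 := pow_pos h.q_pos (k n)
    have h3 : 0 < n * p (k n) / (1 - q) * (q ^ k n)⁻¹ := by positivity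
    have h4 : n * p (k n) * (q ^ k n)⁻¹ / (1 - q) = n * p (k n) / (1 - q) * (q ^ k n)⁻¹ := by ring
    rw [h4]
    exact h3.ne'
  have h1 := ((isEquivalent_iff_tendsto_one hpos).1 hN).sub_const 1
  rw [sub_self] at h1
  have h2 : Tendsto (fun n : ℕ => (n * p (k n) / (1 - q) * q ^ (j + 1)) *
      (N n / (n * p (k n) * (q ^ k n)⁻¹ / (1 - q)) - 1)) atTop (𝓝 0) := by
    refine isBoundedUnder_le_mul_tendsto_zero ?_ h1
    refine isBoundedUnder_of_eventually_le (a := C * q ^ (j + 1)) ?_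
    filter_upwards [hb] with n hn
    have := zpow_pos h.q_pos (j + 1)
    have h3 := hc.trans_le hn.1
    simp only [Function.comp_apply]
    rw [Real.norm_eq_abs, abs_of_nonneg (by positivity)]
    gcongr
    exact hn.2
  refine h2.congr' ?_
  filter_upwards [hb] with n hn
  have h3 : 0 < n * p (k n) / (1 - q) := hc.trans_le hn.1
  have h4 : n * p (k n) ≠ 0 := by
    intro h0
    rw [h0, zero_div] at h3
    exact lt_irrefl _ h3
  have h5 := h.q_pos.ne'
  have h6 : q ^ (k n + j + 1 : ℤ) = q ^ k n * q ^ (j + 1) := by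
    rw [add_assoc, zpow_add₀ h5, zpow_natCast]
  rw [h6]
  generalize n * p (k n) = x at *
  field_simp

/-- The distribution function is `(1 - x)^N` with `x = r^(k n + j + 1) → 0` and `N * x` bounded,
hence `exp (-N * x) + o(1)`. -/
theorem hasGumbelCDF_maxGeometric {r : unitInterval} (h : GeomRatio p (r : ℝ))
    (hk : (fun n => p (k n)) =Θ[atTop] (fun n : ℕ => 1 / (n : ℝ))) {N : ℕ → ℕ}
    (hN : (fun n => (N n : ℝ)) ~[atTop]
      (fun n : ℕ => n * p (k n) * ((r : ℝ) ^ k n)⁻¹ / (1 - r))) :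
    HasGumbelCDF r (fun n => n * p (k n) / (1 - r)) (fun n => k n)
      (fun n => maxGeometric (unitInterval.symm r) (N n)) := by
  have hk' := h.tendsto_atTop_of_isTheta hk
  obtain ⟨c, C, hc, hb⟩ := h.eventually_gumbel_bounds hk
  refine hasGumbelCDF_of_tendsto h.q_pos.le (hb.mono fun n hn => hc.le.trans hn.1) fun j => ?_
  have hd := h.tendsto_equivalent_sub hk hN j
  have hx0 : ∀ n, 0 ≤ N n * (r : ℝ) ^ (k n + j + 1 : ℤ) := fun n =>
    mul_nonneg (Nat.cast_nonneg _) (zpow_nonneg h.q_pos.le _)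
  refine ⟨_, Eventually.of_forall hx0, ?_, hd⟩
  have hxlim : Tendsto (fun n => (r : ℝ) ^ ((k n + j).toNat + 1)) atTop (𝓝 0) :=
    (tendsto_pow_atTop_nhds_zero_of_lt_one h.q_pos.le h.q_lt_one).comp
      ((tendsto_add_atTop_nat 1).comp (tendsto_toNat_add hk' j))
  have hlim2 : Tendsto (fun n => (r : ℝ) ^ ((k n + j).toNat + 1) /
      (1 - (r : ℝ) ^ ((k n + j).toNat + 1))) atTop (𝓝 0) := by
    have := hxlim.div (hxlim.const_sub 1) (by norm_num)
    rw [sub_zero, zero_div] at this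
    exact this
  have hlim3 : Tendsto (fun n => N n * (r : ℝ) ^ (k n + j + 1 : ℤ) *
      ((r : ℝ) ^ ((k n + j).toNat + 1) / (1 - (r : ℝ) ^ ((k n + j).toNat + 1)))) atTop (𝓝 0) := by
    refine isBoundedUnder_le_mul_tendsto_zero ?_ hlim2
    refine isBoundedUnder_of_eventually_le (a := 1 + C * (r : ℝ) ^ (j + 1)) ?_
    filter_upwards [hd.eventually (gt_mem_nhds one_pos), hb] with n h1 h2
    have h3 : n * p (k n) / (1 - r) * (r : ℝ) ^ (j + 1) ≤ C * (r : ℝ) ^ (j + 1) := by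
      have := zpow_pos h.q_pos (j + 1)
      gcongr
      exact h2.2
    simp only [Function.comp_apply]
    rw [Real.norm_eq_abs, abs_of_nonneg (hx0 n)]
    linarith
  rw [tendsto_zero_iff_abs_tendsto_zero]
  refine squeeze_zero' (Eventually.of_forall fun _ => abs_nonneg _) ?_ hlim3
  have hsymm : unitInterval.symm r ≠ 0 := by
    intro h0
    have := congrArg Subtype.val h0
    simp only [unitInterval.coe_symm_eq, Set.Icc.coe_zero] at this
    linarith [h.q_lt_one]
  filter_upwards [hk'.eventually_ge_atTop j.natAbs] with n hkn
  obtain ⟨K, hK⟩ := Int.eq_ofNat_of_zero_le (show (0 : ℤ) ≤ k n + j by omega)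
  have hz : (r : ℝ) ^ (k n + j + 1 : ℤ) = (r : ℝ) ^ (K + 1) := by
    rw [hK]
    exact_mod_cast rfl
  simp only [Function.comp_apply]
  rw [hz, hK, maxGeometric_real_Iic hsymm, unitInterval.coe_symm_eq, sub_sub_cancel,
    Int.toNat_natCast]
  exact abs_one_sub_pow_sub_exp_le (pow_nonneg h.q_pos.le _)
    (pow_lt_one₀ h.q_pos.le h.q_lt_one (Nat.succ_ne_zero _)) _

theorem hasGumbelCDF_gumbel_logb (h : GeomRatio p q)
    (hk : (fun n => p (k n)) =Θ[atTop] (fun n : ℕ => 1 / (n : ℝ))) {N : ℕ → ℕ}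
    (hN : (fun n => (N n : ℝ)) ~[atTop] (fun n : ℕ => n * p (k n) * (q ^ k n)⁻¹ / (1 - q))) :
    HasGumbelCDF q (fun n => n * p (k n) / (1 - q)) (fun n => k n)
      (fun n => gumbel.map (fun x => ⌊x / Real.log (1 / q) + Real.logb (1 / q) (N n)⌋)) := by
  obtain ⟨c, C, hc, hb⟩ := h.eventually_gumbel_bounds hk
  refine hasGumbelCDF_of_tendsto h.q_pos.le (hb.mono fun n hn => hc.le.trans hn.1) fun j => ?_
  have hd := h.tendsto_equivalent_sub hk hN j
  refine ⟨_, Eventually.of_forall fun n => mul_nonneg (Nat.cast_nonneg _)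
    (zpow_nonneg h.q_pos.le _), ?_, hd⟩
  refine tendsto_const_nhds.congr' ?_
  have hq := zpow_pos h.q_pos (j + 1)
  filter_upwards [hb, hd.eventually (lt_mem_nhds
    (show -(c * q ^ (j + 1)) < 0 by nlinarith))] with n hn h1
  have h2 : c * q ^ (j + 1) ≤ n * p (k n) / (1 - q) * q ^ (j + 1) := by
    gcongr
    exact hn.1
  -- The logarithm requires `N n ≠ 0`, which follows because `N n * q^(k n + j + 1)` stays close to
  -- a quantity bounded below.
  have hN0 : (0 : ℝ) < N n := by
    have h3 : 0 < N n * q ^ (k n + j + 1 : ℤ) := by linarith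
    exact pos_of_mul_pos_left h3 (zpow_pos h.q_pos _).le
  rw [eq_comm, sub_eq_zero]
  exact gumbel_map_floor_real_Iic h.q_pos h.q_lt_one hN0 _

theorem hasGumbelCDF_gumbel_log {B : ℕ → ℝ} (hq0 : 0 < q) (hq1 : q < 1)
    (hB : ∀ᶠ n in atTop, 0 < B n) :
    HasGumbelCDF q B 0
      (fun n => gumbel.map (fun x => ⌊(x + Real.log (B n)) / Real.log (1 / q)⌋)) := by
  intro j
  refine tendsto_const_nhds.congr' ?_
  filter_upwards [hB] with n hn
  simp_rw [add_div, Pi.zero_apply, zero_add]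
  rw [gumbel_map_floor_real_Iic hq0 hq1 hn, sub_self]

theorem HasGumbelCDF.map_sub {B : ℕ → ℝ} {P : ℕ → PMF ℤ}
    (h : HasGumbelCDF q B (fun n => k n) fun n => (P n).toMeasure) :
    HasGumbelCDF q B 0 fun n => ((P n).map fun y => y - (k n : ℤ)).toMeasure := by
  intro j
  refine (h j).congr fun n => ?_
  congr 1
  simp only
  rw [← PMF.toMeasure_map _ (P n) (Measurable.of_discrete (f := fun y : ℤ => y - (k n : ℤ))),
    map_measureReal_apply .of_discrete measurableSet_Iic]
  congr 1
  ext x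
  simp only [Set.mem_Iic, Pi.zero_apply, zero_add, Set.mem_preimage]
  omega

end

/-! ### The tilting parameter -/

/-- Polynomial factors do not change the limit ratio, so all moments are finite. -/
theorem GeomRatio.pow_mul {p : ℕ → ℝ} {q : ℝ} (h : GeomRatio p q) (r : ℕ) :
    GeomRatio (fun k => (k : ℝ) ^ r * p k) q where
  nonneg k := mul_nonneg (by positivity) (h.nonneg k)
  q_pos := h.q_pos
  q_lt_one := h.q_lt_one
  ratio := by
    have h1 : Tendsto (fun k : ℕ => (1 + 1 / (k : ℝ)) ^ r) atTop (𝓝 1) := by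
      have := (tendsto_one_div_atTop_nhds_zero_nat (𝕜 := ℝ).const_add 1).pow r
      simpa only [add_zero, one_pow] using this
    have h2 := h1.mul h.ratio
    rw [one_mul] at h2
    refine h2.congr' ?_
    filter_upwards [eventually_gt_atTop 0] with k hk
    have hk' : (k : ℝ) ≠ 0 := by exact_mod_cast hk.ne'
    rw [mul_div_mul_comm, ← div_pow]
    push_cast
    rw [add_div, div_self hk']

section

variable {w : ℕ → ℝ≥0} {a : ℝ}

theorem exists_ofReal_eq {x : ℝ≥0∞} (hx : x ≠ ∞) : ∃ y : ℝ, 0 ≤ y ∧ x = ENNReal.ofReal y :=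
  ⟨x.toReal, ENNReal.toReal_nonneg, (ENNReal.ofReal_toReal hx).symm⟩

theorem mean_sum_zero (w : ℕ → ℝ≥0) : ∑' k : ℕ, (k : ℝ) * (w k * (0 : ℝ) ^ k) = 0 := by
  rw [← tsum_zero (α := ℝ) (β := ℕ)]
  refine tsum_congr fun k => ?_
  rcases k.eq_zero_or_pos with rfl | hk
  · simp
  · simp [hk.ne']

theorem geomRatio_weights (ha : 0 < a)
    (hw : Tendsto (fun k => (w (k + 1) : ℝ) / (w k : ℝ)) atTop (𝓝 a)) {t s : ℝ} (ht : 0 < t)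
    (hta : t < a⁻¹) (hs : 0 < s) : GeomRatio (fun k => w k * t ^ k / s) (t * a) where
  nonneg k := by positivity
  q_pos := by positivity
  q_lt_one := by rwa [lt_inv_comm₀ ht ha, inv_eq_one_div, lt_div_iff₀ ht, mul_comm] at hta
  ratio := by
    rw [mul_comm]
    refine (hw.mul_const t).congr fun k => ?_
    rw [pow_succ]
    have := pow_pos ht k
    rw [div_div_div_cancel_right₀ hs.ne', ← mul_assoc, mul_right_comm, mul_div_mul_right _ _ this.ne']
    ring

theorem summable_pow_mul_weights (ha : 0 < a)
    (hw : Tendsto (fun k => (w (k + 1) : ℝ) / (w k : ℝ)) atTop (𝓝 a)) {t : ℝ} (ht : 0 ≤ t)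
    (hta : t < a⁻¹) (r : ℕ) : Summable fun k : ℕ => (k : ℝ) ^ r * (w k * t ^ k) := by
  rcases ht.eq_or_lt with rfl | ht
  · refine summable_of_ne_finset_zero (s := {0}) fun k hk => ?_
    rw [Finset.mem_singleton] at hk
    simp [hk]
  · simpa using ((geomRatio_weights ha hw ht hta one_pos).pow_mul r).summable

theorem rho_eq (ha : 0 < a)
    (hw : Tendsto (fun k => (w (k + 1) : ℝ) / (w k : ℝ)) atTop (𝓝 a)) :
    rho w = ENNReal.ofReal a⁻¹ := by
  have := FormalMultilinearSeries.ofScalars_radius_eq_inv_of_tendsto ℝ (fun k => (w k : ℝ))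
    (r := a.toNNReal) (Real.toNNReal_pos.2 ha).ne' (by
      rw [Real.coe_toNNReal a ha.le]
      simpa using hw)
  rw [rho, this, ← Real.toNNReal_inv]
  rfl

theorem genFun_eq (ha : 0 < a)
    (hw : Tendsto (fun k => (w (k + 1) : ℝ) / (w k : ℝ)) atTop (𝓝 a)) {t : ℝ} (ht : 0 ≤ t)
    (hta : t < a⁻¹) : genFun w (ENNReal.ofReal t) = ENNReal.ofReal (∑' k : ℕ, w k * t ^ k) := by
  have hs := summable_pow_mul_weights ha hw ht hta 0
  simp only [pow_zero, one_mul] at hs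
  rw [ENNReal.ofReal_tsum_of_nonneg (fun k => by positivity) hs, genFun]
  refine tsum_congr fun k => ?_
  rw [ENNReal.ofReal_mul (by positivity), ENNReal.ofReal_coe_nnreal, ENNReal.ofReal_pow ht]

theorem genFun_sum_pos (hw0 : 0 < w 0) (ha : 0 < a)
    (hw : Tendsto (fun k => (w (k + 1) : ℝ) / (w k : ℝ)) atTop (𝓝 a)) {t : ℝ} (ht : 0 ≤ t)
    (hta : t < a⁻¹) : 0 < ∑' k : ℕ, w k * t ^ k := by
  have hs := summable_pow_mul_weights ha hw ht hta 0
  simp only [pow_zero, one_mul] at hs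
  refine hs.tsum_pos (fun k => by positivity) 0 ?_
  simpa using hw0

theorem psiQuot_eq (hw0 : 0 < w 0) (ha : 0 < a)
    (hw : Tendsto (fun k => (w (k + 1) : ℝ) / (w k : ℝ)) atTop (𝓝 a)) {t : ℝ} (ht : 0 ≤ t)
    (hta : t < a⁻¹) : psiQuot w (ENNReal.ofReal t) =
      ENNReal.ofReal ((∑' k : ℕ, k * (w k * t ^ k)) / ∑' k : ℕ, w k * t ^ k) := by
  have hs := summable_pow_mul_weights ha hw ht hta 1
  simp only [pow_one] at hs
  rw [psiQuot, genFun_eq ha hw ht hta, ENNReal.ofReal_div_of_pos (genFun_sum_pos hw0 ha hw ht hta),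
    ENNReal.ofReal_tsum_of_nonneg (fun k => by positivity) hs]
  congr 1
  refine tsum_congr fun k => ?_
  rw [ENNReal.ofReal_mul (by positivity), ENNReal.ofReal_mul (by positivity),
    ENNReal.ofReal_coe_nnreal, ENNReal.ofReal_pow ht, ENNReal.ofReal_natCast]

theorem psi_eq (hw0 : 0 < w 0) (ha : 0 < a)
    (hw : Tendsto (fun k => (w (k + 1) : ℝ) / (w k : ℝ)) atTop (𝓝 a)) {t : ℝ} (ht : 0 ≤ t)
    (hta : t < a⁻¹) : psi w (ENNReal.ofReal t) =
      ENNReal.ofReal ((∑' k : ℕ, k * (w k * t ^ k)) / ∑' k : ℕ, w k * t ^ k) := by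
  rw [psi, if_pos, psiQuot_eq hw0 ha hw ht hta]
  rw [genFun_eq ha hw ht hta]
  exact ENNReal.ofReal_lt_top

theorem mean_sum_pos (ha : 0 < a)
    (hw : Tendsto (fun k => (w (k + 1) : ℝ) / (w k : ℝ)) atTop (𝓝 a)) {t : ℝ} (ht : 0 < t)
    (hta : t < a⁻¹) : 0 < ∑' k : ℕ, k * (w k * t ^ k) := by
  have hs := summable_pow_mul_weights ha hw ht.le hta 1
  simp only [pow_one] at hs
  obtain ⟨k, hk, hk1⟩ := ((geomRatio_weights ha hw ht hta one_pos).eventually_pos.and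
    (eventually_gt_atTop 0)).exists
  rw [div_one] at hk
  exact hs.tsum_pos (fun k => by positivity) k (mul_pos (by exact_mod_cast hk1) hk)

/-- Strict monotonicity of `Ψ` on `(0, ρ)`. -/
theorem mean_div_lt (hw0 : 0 < w 0) (ha : 0 < a)
    (hw : Tendsto (fun k => (w (k + 1) : ℝ) / (w k : ℝ)) atTop (𝓝 a)) {s t : ℝ} (hs : 0 < s)
    (hst : s < t) (hta : t < a⁻¹) :
    (∑' k : ℕ, k * (w k * s ^ k)) / ∑' k : ℕ, w k * s ^ k <
      (∑' k : ℕ, k * (w k * t ^ k)) / ∑' k : ℕ, w k * t ^ k := by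
  have hsa := hst.trans hta
  have ht := hs.trans hst
  have hs0 := summable_pow_mul_weights ha hw hs.le hsa 0
  have hs1 := summable_pow_mul_weights ha hw hs.le hsa 1
  have ht0 := summable_pow_mul_weights ha hw ht.le hta 0
  have ht1 := summable_pow_mul_weights ha hw ht.le hta 1
  simp only [pow_zero, one_mul, pow_one] at hs0 hs1 ht0 ht1
  have hsp := genFun_sum_pos hw0 ha hw hs.le hsa
  have htp := genFun_sum_pos hw0 ha hw ht.le hta
  have hl : 0 < (∑' k : ℕ, k * (w k * s ^ k)) / ∑' k : ℕ, w k * s ^ k :=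
    div_pos (mean_sum_pos ha hw hs hsa) hsp
  set l := (∑' k : ℕ, k * (w k * s ^ k)) / ∑' k : ℕ, w k * s ^ k with hldef
  -- With `l = Ψ(s)`, the sum `∑ (k - l) w_k s^k` vanishes. Passing to `t` multiplies its terms by
  -- `(t/s)^k`; replacing this by `(t/s)^l` can only lower each term, since `k - l` and `(t/s)^k -
  -- (t/s)^l` have the same sign. The term `k = 0` gives strictness.
  have hcs := hs1.hasSum.sub (hs0.hasSum.mul_left l)
  rw [hldef, div_mul_cancel₀ _ hsp.ne', sub_self, ← hldef] at hcs
  have hct := ht1.hasSum.sub (ht0.hasSum.mul_left l)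
  have hx1 : 1 < t / s := (one_lt_div hs).2 hst
  have hx0 : 0 < t / s := by linarith
  have hcs' := hcs.mul_left ((t / s) ^ l)
  rw [mul_zero] at hcs'
  have htk : ∀ k : ℕ, t ^ k = (t / s) ^ (k : ℝ) * s ^ k := by
    intro k
    rw [Real.rpow_natCast, div_pow, div_mul_cancel₀ _ (pow_pos hs k).ne']
  have hle : ∀ k : ℕ, (t / s) ^ l * (k * (w k * s ^ k) - l * (w k * s ^ k)) ≤
      k * (w k * t ^ k) - l * (w k * t ^ k) := by
    intro k
    rw [htk k]
    have hws : 0 ≤ (w k : ℝ) * s ^ k := by positivity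
    have hkey : 0 ≤ ((k : ℝ) - l) * ((t / s) ^ (k : ℝ) - (t / s) ^ l) := by
      rcases le_total l k with hlk | hlk
      · exact mul_nonneg (by linarith)
          (sub_nonneg.2 (Real.rpow_le_rpow_of_exponent_le hx1.le hlk))
      · exact mul_nonneg_of_nonpos_of_nonpos (by linarith)
          (sub_nonpos.2 (Real.rpow_le_rpow_of_exponent_le hx1.le hlk))
    nlinarith [mul_nonneg hws hkey]
  have hlt : (t / s) ^ l * ((0 : ℕ) * (w 0 * s ^ 0) - l * (w 0 * s ^ 0)) <
      (0 : ℕ) * (w 0 * t ^ 0) - l * (w 0 * t ^ 0) := by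
    have h1 : 1 < (t / s) ^ l := Real.one_lt_rpow hx1 hl
    have h2 : 0 < l * w 0 := mul_pos hl (by exact_mod_cast hw0)
    simp only [Nat.cast_zero, zero_mul, zero_sub, pow_zero, mul_one]
    nlinarith
  have hfin := hasSum_lt hle hlt hcs' hct
  rw [lt_div_iff₀ htp]
  linarith

theorem continuousOn_power_series (ha : 0 < a)
    (hw : Tendsto (fun k => (w (k + 1) : ℝ) / (w k : ℝ)) atTop (𝓝 a)) {b : ℝ} (hb : 0 ≤ b)
    (hba : b < a⁻¹) (r : ℕ) :
    ContinuousOn (fun t : ℝ => ∑' k : ℕ, (k : ℝ) ^ r * (w k * t ^ k)) (Set.Icc 0 b) := by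
  refine continuousOn_tsum (fun k => by fun_prop) (summable_pow_mul_weights ha hw hb hba r) ?_
  intro k t ht
  rw [Real.norm_eq_abs, abs_of_nonneg (by have := ht.1; positivity)]
  have := ht.1
  gcongr
  exact ht.2

/-- This moves the condition at `ρ` strictly inside the disc, where the intermediate value theorem
applies. If `Φ(ρ) < ∞`, the numerator may still be infinite, so a continuous finite partial sum
replaces it, while the denominator only decreases to the left. If `Φ(ρ) = ∞`, the left limit of the
monotone quotient is its supremum. -/
theorem exists_lt_psiQuot (hw0 : 0 < w 0) (ha : 0 < a)
    (hw : Tendsto (fun k => (w (k + 1) : ℝ) / (w k : ℝ)) atTop (𝓝 a)) {x : ℝ≥0∞}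
    (hx : x < nu w) : ∃ t < rho w, x < psiQuot w t := by
  have hrho : rho w ≠ ∞ := by rw [rho_eq ha hw]; exact ENNReal.ofReal_ne_top
  have hrho0 : 0 < rho w := by rw [rho_eq ha hw, ENNReal.ofReal_pos]; positivity
  have : (𝓝[<] rho w).NeBot := nhdsLT_neBot_of_exists_lt ⟨0, hrho0⟩
  rw [nu, psi] at hx
  split_ifs at hx with hfin
  · rw [psiQuot] at hx
    have hpos : ∀ t, genFun w t ≠ 0 := by
      intro t h0
      have : (w 0 : ℝ≥0∞) ≤ genFun w t := by
        have := ENNReal.le_tsum (f := fun k : ℕ => (w k : ℝ≥0∞) * t ^ k) 0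
        rw [pow_zero, mul_one] at this
        exact this
      rw [h0] at this
      exact hw0.ne' (by simpa using this)
    rw [ENNReal.lt_div_iff_mul_lt (.inl (hpos _)) (.inl hfin.ne), ENNReal.tsum_eq_iSup_sum,
      lt_iSup_iff] at hx
    obtain ⟨F, hF⟩ := hx
    have hc : Continuous fun t : ℝ≥0∞ => ∑ k ∈ F, (k : ℝ≥0∞) * ((w k : ℝ≥0∞) * t ^ k) := by
      refine continuous_finsetSum _ fun k _ => ?_
      exact (ENNReal.continuous_const_mul (ENNReal.natCast_ne_top k)).comp
        ((ENNReal.continuous_const_mul ENNReal.coe_ne_top).comp (ENNReal.continuous_pow k))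
    have hev := (hc.tendsto (rho w)).eventually (lt_mem_nhds hF)
    obtain ⟨t, ht, htr⟩ := ((hev.filter_mono nhdsWithin_le_nhds).and
      self_mem_nhdsWithin : ∀ᶠ t in 𝓝[<] rho w, _ ∧ t ∈ Set.Iio (rho w)).exists
    have hmono : genFun w t ≤ genFun w (rho w) := by
      refine ENNReal.tsum_le_tsum fun k => ?_
      gcongr
      exact (Set.mem_Iio.1 htr).le
    refine ⟨t, htr, ?_⟩
    rw [psiQuot, ENNReal.lt_div_iff_mul_lt (.inl (hpos _)) (.inl (hmono.trans_lt hfin).ne)]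
    refine lt_of_le_of_lt ?_ (ht.trans_le (ENNReal.sum_le_tsum F))
    gcongr
  · by_contra! hcon
    have hmono : MonotoneOn (psiQuot w) (Set.Iio (rho w)) := by
      intro s hs t ht hst
      rw [Set.mem_Iio, rho_eq ha hw] at hs ht
      obtain ⟨s, hs0, rfl⟩ := exists_ofReal_eq hs.ne_top
      obtain ⟨t, ht0, rfl⟩ := exists_ofReal_eq ht.ne_top
      have hainv : 0 < a⁻¹ := inv_pos.2 ha
      have hsa := (ENNReal.ofReal_lt_ofReal_iff hainv).1 hs
      have hta := (ENNReal.ofReal_lt_ofReal_iff hainv).1 ht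
      rw [psiQuot_eq hw0 ha hw hs0 hsa, psiQuot_eq hw0 ha hw ht0 hta]
      refine ENNReal.ofReal_le_ofReal ?_
      rw [ENNReal.ofReal_le_ofReal_iff ht0] at hst
      rcases hst.eq_or_lt with heq | hlt
      · rw [heq]
      · rcases hs0.eq_or_lt with h0 | h0
        · rw [← h0, mean_sum_zero, zero_div]
          exact div_nonneg (tsum_nonneg fun k => by positivity)
            (tsum_nonneg fun k => by positivity)
        · exact (mean_div_lt hw0 ha hw h0 hlt hta).le
    have hlim := hmono.tendsto_nhdsLT (OrderTop.bddAbove _)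
    rw [hlim.limUnder_eq] at hx
    refine absurd hx (not_lt.2 ?_)
    refine sSup_le ?_
    rintro _ ⟨t, ht, rfl⟩
    exact hcon t ht

/-- Existence of the solution of `Ψ(t) = lam` in `(0, ρ)`. -/
theorem exists_mean_div_eq (hw0 : 0 < w 0) (ha : 0 < a)
    (hw : Tendsto (fun k => (w (k + 1) : ℝ) / (w k : ℝ)) atTop (𝓝 a)) {lam : ℝ} (hlam : 0 < lam)
    (hnu : ENNReal.ofReal lam < nu w) : ∃ t : ℝ, 0 < t ∧ t < a⁻¹ ∧
      (∑' k : ℕ, k * (w k * t ^ k)) / ∑' k : ℕ, w k * t ^ k = lam := by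
  obtain ⟨b, hb, hlb⟩ := exists_lt_psiQuot hw0 ha hw hnu
  obtain ⟨β, hb0, rfl⟩ := exists_ofReal_eq hb.ne_top
  rw [rho_eq ha hw, ENNReal.ofReal_lt_ofReal_iff (inv_pos.2 ha)] at hb
  rw [psiQuot_eq hw0 ha hw hb0 hb] at hlb
  have hlb' := (ENNReal.ofReal_lt_ofReal_iff_of_nonneg hlam.le).1 hlb
  have hc1 := continuousOn_power_series ha hw hb0 hb 1
  have hc0 := continuousOn_power_series ha hw hb0 hb 0
  simp only [pow_one, pow_zero, one_mul] at hc1 hc0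
  have hc := hc1.div hc0 fun t ht => (genFun_sum_pos hw0 ha hw ht.1 (ht.2.trans_lt hb)).ne'
  obtain ⟨t, ht, htl⟩ := intermediate_value_Icc hb0 hc
    (show lam ∈ Set.Icc _ _ from ⟨by rw [Pi.div_apply, mean_sum_zero, zero_div]; exact hlam.le, hlb'.le⟩)
  refine ⟨t, lt_of_le_of_ne ht.1 ?_, ht.2.trans_lt hb, htl⟩
  rintro rfl
  rw [Pi.div_apply, mean_sum_zero, zero_div] at htl
  exact hlam.ne htl

/-- The endpoint `ρ` is excluded by `Ψ(ρ) = ν > lam` and `0` by `Ψ(0) = 0`; in between `Ψ` is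
strictly increasing. -/
theorem eq_of_psi_eq (hw0 : 0 < w 0) (ha : 0 < a)
    (hw : Tendsto (fun k => (w (k + 1) : ℝ) / (w k : ℝ)) atTop (𝓝 a)) {lam : ℝ} (hlam : 0 < lam)
    (hnu : ENNReal.ofReal lam < nu w) {τ : ℝ} (hτ : 0 < τ) (hτa : τ < a⁻¹)
    (hτl : (∑' k : ℕ, k * (w k * τ ^ k)) / ∑' k : ℕ, w k * τ ^ k = lam) {t : ℝ≥0∞}
    (ht : t ≤ rho w) (htl : psi w t = ENNReal.ofReal lam) : t = ENNReal.ofReal τ := by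
  rcases ht.eq_or_lt with rfl | ht
  · exact absurd htl hnu.ne'
  rw [rho_eq ha hw] at ht
  obtain ⟨s, hs, rfl⟩ := exists_ofReal_eq ht.ne_top
  have hta := (ENNReal.ofReal_lt_ofReal_iff (inv_pos.2 ha)).1 ht
  rw [psi_eq hw0 ha hw hs hta] at htl
  have hs0 : 0 < s := by
    refine lt_of_le_of_ne hs fun h0 => ?_
    rw [← h0, mean_sum_zero, zero_div, ENNReal.ofReal_zero, eq_comm, ENNReal.ofReal_eq_zero] at htl
    linarith
  have hpos := div_pos (mean_sum_pos ha hw hs0 hta) (genFun_sum_pos hw0 ha hw hs0.le hta)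
  rw [ENNReal.ofReal_eq_ofReal_iff hpos.le hlam.le, ← hτl] at htl
  rcases lt_trichotomy s τ with h | h | h
  · exact absurd htl (mean_div_lt hw0 ha hw hs0 h hτa).ne
  · rw [h]
  · exact absurd htl (mean_div_lt hw0 ha hw hτ h hta).ne'

theorem latticeLaw_weights (hw0 : 0 < w 0) (ha : 0 < a)
    (hw : Tendsto (fun k => (w (k + 1) : ℝ) / (w k : ℝ)) atTop (𝓝 a)) {lam τ : ℝ} (hlam : 0 < lam)
    (hτ : 0 < τ) (hτa : τ < a⁻¹)
    (hτl : (∑' k : ℕ, k * (w k * τ ^ k)) / ∑' k : ℕ, w k * τ ^ k = lam) :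
    LatticeLaw (fun k => w k * τ ^ k / ∑' k : ℕ, w k * τ ^ k) lam := by
  have hp := genFun_sum_pos hw0 ha hw hτ.le hτa
  have h0 := summable_pow_mul_weights ha hw hτ.le hτa 0
  have h1 := summable_pow_mul_weights ha hw hτ.le hτa 1
  have hg := geomRatio_weights ha hw hτ hτa hp
  simp only [pow_zero, one_mul, pow_one] at h0 h1
  set S := ∑' k : ℕ, w k * τ ^ k
  refine ⟨hg.nonneg, ?_, ?_, (hg.pow_mul 2).summable, ?_, hlam, ?_⟩
  · have := h0.hasSum.div_const S
    rwa [div_self hp.ne'] at this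
  · have := h1.hasSum.div_const S
    rw [hτl] at this
    simpa only [mul_div_assoc] using this
  · have : (0 : ℝ) < w 0 := by exact_mod_cast hw0
    positivity
  · exact (hg.eventually_pos.and ((tendsto_add_atTop_nat 1).eventually hg.eventually_pos)).exists

end

end BallsInBoxes

/-! ### The main theorem -/

theorem mainTheorem11 (w : ℕ → ℝ≥0) (a lam : ℝ) (m : ℕ → ℕ)
    (hw0 : 0 < w 0)
    (ha : 0 < a)
    (hw : Tendsto (fun k => (w (k + 1) : ℝ) / (w k : ℝ)) atTop (𝓝 a))
    (hlam : 0 < lam)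
    (hnu : ENNReal.ofReal lam < BallsInBoxes.nu w)
    (hm : (fun n : ℕ => (m n : ℝ) - lam * n) =o[atTop] (fun n : ℕ => √(n : ℝ))) :
    -- the random allocation exists for all large `n`
    (∀ᶠ n in atTop, 0 < BallsInBoxes.partitionFun w (m n) n) ∧
    -- `τ` is the unique solution in `[0, ρ]` of `Ψ(τ) = λ`, and `q = τ a = τ / ρ < 1`
    ∃ (τ : ℝ≥0) (q : unitInterval),
      ((τ : ℝ≥0∞) ≤ BallsInBoxes.rho w ∧
        BallsInBoxes.psi w τ = ENNReal.ofReal lam ∧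
        ∀ t : ℝ≥0∞, t ≤ BallsInBoxes.rho w →
          BallsInBoxes.psi w t = ENNReal.ofReal lam → t = τ) ∧
      ((q : ℝ) = τ * a ∧ ENNReal.ofReal (q : ℝ) = τ / BallsInBoxes.rho w ∧
        0 < (q : ℝ) ∧ (q : ℝ) < 1) ∧
      -- `π_{k(n)} = Θ(1/n)` if and only if `k(n) = k₁(n) + O(1)`
      (∀ k : ℕ → ℕ,
        (fun n => BallsInBoxes.boxProb w τ (k n)) =Θ[atTop] (fun n : ℕ => 1 / (n : ℝ)) ↔
        (fun n => (k n : ℝ) - (BallsInBoxes.kOne w τ n : ℝ)) =O[atTop] (fun _ => (1 : ℝ))) ∧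
      ∀ k : ℕ → ℕ,
        (fun n => BallsInBoxes.boxProb w τ (k n)) =Θ[atTop] (fun n : ℕ => 1 / (n : ℝ)) →
        -- the two expressions for the asymptotic size of `N` agree
        (∀ n : ℕ, (n : ℝ) * BallsInBoxes.boxProb w τ (k n) * ((q : ℝ) ^ k n)⁻¹ / (1 - q) =
          (n : ℝ) * w (k n) * (a ^ k n)⁻¹ / ((BallsInBoxes.genFun w τ).toReal * (1 - q))) ∧
        (∀ N : ℕ → ℕ,
          (fun n => (N n : ℝ)) ~[atTop]
            (fun n : ℕ =>
              (n : ℝ) * BallsInBoxes.boxProb w τ (k n) * ((q : ℝ) ^ k n)⁻¹ / (1 - q)) →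
          -- (i)
          BallsInBoxes.DApprox (fun n => (BallsInBoxes.maxOccupancy w (m n) n).toMeasure)
            (fun n => BallsInBoxes.maxGeometric (unitInterval.symm q) (N n)) ∧
          -- (ii)
          BallsInBoxes.DApprox (fun n => (BallsInBoxes.maxOccupancy w (m n) n).toMeasure)
            (fun n => BallsInBoxes.gumbel.map
              (fun x => ⌊x / Real.log (1 / (q : ℝ)) + Real.logb (1 / (q : ℝ)) (N n)⌋))) ∧
        -- (iii)
        (fun n : ℕ => (n : ℝ) * BallsInBoxes.boxProb w τ (k n)) =Θ[atTop] (fun _ => (1 : ℝ)) ∧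
        BallsInBoxes.DApprox
          (fun n => ((BallsInBoxes.maxOccupancy w (m n) n).map (fun y => y - (k n : ℤ))).toMeasure)
          (fun n => BallsInBoxes.gumbel.map
            (fun x => ⌊(x + Real.log ((n : ℝ) * BallsInBoxes.boxProb w τ (k n) / (1 - q))) /
              Real.log (1 / (q : ℝ))⌋)) ∧
        IsTightMeasureSet (Set.range fun n =>
          ((BallsInBoxes.maxOccupancy w (m n) n).map (fun y => y - (k n : ℤ))).toMeasure) ∧
        -- convergence in distribution along every subsequence along which `b_n` converges
        (∀ (φ : ℕ → ℕ) (b : ℝ), StrictMono φ →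
          Tendsto (fun j => (φ j : ℝ) * BallsInBoxes.boxProb w τ (k (φ j))) atTop (𝓝 b) →
          ∃ L : ProbabilityMeasure ℤ,
            (L : Measure ℤ) = BallsInBoxes.gumbel.map
              (fun x => ⌊(x + Real.log (b / (1 - q))) / Real.log (1 / (q : ℝ))⌋) ∧
            Tendsto (fun j => BallsInBoxes.toProb
              ((BallsInBoxes.maxOccupancy w (m (φ j)) (φ j)).map
                (fun y => y - (k (φ j) : ℤ)))) atTop (𝓝 L)) ∧
        -- there is no limit distribution
        ¬ ∃ L : ProbabilityMeasure ℤ,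
          Tendsto (fun n => BallsInBoxes.toProb
            ((BallsInBoxes.maxOccupancy w (m n) n).map (fun y => y - (k n : ℤ)))) atTop (𝓝 L) := by
  obtain ⟨t, ht0, hta, htl⟩ := BallsInBoxes.exists_mean_div_eq hw0 ha hw hlam hnu
  have hS := BallsInBoxes.genFun_sum_pos hw0 ha hw ht0.le hta
  have hL := BallsInBoxes.latticeLaw_weights hw0 ha hw hlam ht0 hta htl
  have hG := BallsInBoxes.geomRatio_weights ha hw ht0 hta hS
  have hgen := BallsInBoxes.genFun_eq ha hw ht0.le hta
  have hpsi := BallsInBoxes.psi_eq hw0 ha hw ht0.le hta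
  rw [htl] at hpsi
  set S := ∑' k : ℕ, w k * t ^ k
  have hτ : ((t.toNNReal : ℝ≥0) : ℝ) = t := Real.coe_toNNReal t ht0.le
  have hgen' : (BallsInBoxes.genFun w (t.toNNReal : ℝ≥0)).toReal = S := by
    have : ((t.toNNReal : ℝ≥0) : ℝ≥0∞) = ENNReal.ofReal t := rfl
    rw [this, hgen, ENNReal.toReal_ofReal hS.le]
  have hbox : BallsInBoxes.boxProb w t.toNNReal = fun k => w k * t ^ k / S := by
    funext k
    rw [BallsInBoxes.boxProb, hτ, hgen']
  have hq0 := hG.q_pos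
  have hq1 := hG.q_lt_one
  refine ⟨BallsInBoxes.eventually_partitionFun_pos ht0 hS hL hm, t.toNNReal,
    ⟨t * a, hq0.le, hq1.le⟩, ⟨?_, hpsi, fun s hs hsl =>
      BallsInBoxes.eq_of_psi_eq hw0 ha hw hlam hnu ht0 hta htl hs hsl⟩, ⟨by rw [hτ], ?_, hq0, hq1⟩,
    ?_, ?_⟩
  · rw [BallsInBoxes.rho_eq ha hw]
    exact ENNReal.ofReal_le_ofReal hta.le
  · rw [BallsInBoxes.rho_eq ha hw]
    change ENNReal.ofReal (t * a) = ENNReal.ofReal t / ENNReal.ofReal a⁻¹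
    rw [← ENNReal.ofReal_div_of_pos (inv_pos.2 ha), div_inv_eq_mul]
  · intro k
    unfold BallsInBoxes.kOne
    rw [hbox]
    exact hG.isTheta_iff_sSup k
  · intro k hk
    rw [hgen']
    rw [hbox] at hk ⊢
    obtain ⟨c, C, hc, hb⟩ := hG.eventually_gumbel_bounds hk
    have hY := BallsInBoxes.hasGumbelCDF_maxOccupancy ht0 hS hL hG hm hk
    have hY0 := hY.map_sub
    refine ⟨fun n => ?_, fun N hN => ⟨?_, ?_⟩, ?_, ?_, ?_, ?_, ?_⟩
    · have h1 : t ^ k n ≠ 0 := (pow_pos ht0 _).ne'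
      have h2 : a ^ k n ≠ 0 := (pow_pos ha _).ne'
      have h3 : 1 - t * a ≠ 0 := by linarith
      simp only [mul_pow]
      field_simp
    · exact hY.dApprox (BallsInBoxes.hasGumbelCDF_maxGeometric (r := ⟨t * a, hq0.le, hq1.le⟩)
        hG hk hN) hq0 hq1 hc hb
    · exact hY.dApprox (BallsInBoxes.hasGumbelCDF_gumbel_logb hG hk hN) hq0 hq1 hc hb
    · have h1 := (isTheta_refl (fun n : ℕ => (n : ℝ)) atTop).mul hk
      refine h1.trans (EventuallyEq.isTheta ?_)
      filter_upwards [eventually_gt_atTop 0] with n hn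
      have : (n : ℝ) ≠ 0 := by exact_mod_cast hn.ne'
      field_simp
    · have h1 := BallsInBoxes.hasGumbelCDF_gumbel_log hq0 hq1
        (hb.mono fun n hn => hc.trans_le hn.1)
      have (n : ℕ) : IsProbabilityMeasure (BallsInBoxes.gumbel.map fun x =>
          ⌊(x + Real.log (n * (w (k n) * t ^ k n / S) / (1 - t * a))) /
            Real.log (1 / (t * a))⌋) := by
        simp_rw [add_div]
        infer_instance
      exact hY0.dApprox h1 hq0 hq1 hc hb
    · exact hY0.isTightMeasureSet hq0 hq1 hc hb
    · intro φ b hφ hlim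
      have hB := hlim.div_const (1 - t * a)
      have hbφ := hφ.tendsto_atTop.eventually hb
      have hbpos : 0 < b / (1 - t * a) :=
        hc.trans_le (ge_of_tendsto hB (hbφ.mono fun n hn => hn.1))
      have hprob : IsProbabilityMeasure (BallsInBoxes.gumbel.map fun x =>
          ⌊(x + Real.log (b / (1 - t * a))) / Real.log (1 / (t * a))⌋) := by
        simp_rw [add_div]
        infer_instance
      refine ⟨⟨_, hprob⟩, rfl, BallsInBoxes.tendsto_of_dApprox ?_⟩
      have h1 := BallsInBoxes.HasGumbelCDF.const (q := t * a) hB (L := BallsInBoxes.gumbel.map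
        fun x => ⌊(x + Real.log (b / (1 - t * a))) / Real.log (1 / (t * a))⌋) fun j => by
          simp_rw [add_div]
          exact BallsInBoxes.gumbel_map_floor_real_Iic hq0 hq1 hbpos j
      have h2 := (hY0.comp hφ).dApprox h1 hq0 hq1 hc hbφ
      exact h2
    · rintro ⟨L, hLim⟩
      obtain ⟨b, hlim⟩ := BallsInBoxes.HasGumbelCDF.exists_tendsto
        (P := fun n => BallsInBoxes.toProb ((BallsInBoxes.maxOccupancy w (m n) n).map
          fun y => y - (k n : ℤ))) hY0 hLim (hb.mono fun n hn => hn.2)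
      have hbpos : 0 < b := hc.trans_le (ge_of_tendsto hlim (hb.mono fun n hn => hn.1))
      have h1 : 0 < 1 - t * a := by linarith
      refine hG.not_tendsto_mul (hG.tendsto_atTop_of_isTheta hk) (mul_pos hbpos h1)
        ((hlim.mul_const (1 - t * a)).congr fun n => ?_)
      rw [div_mul_cancel₀ _ h1.ne']
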